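/- For every $n$ let $\mathbf d=\mathbf d^{(n)}=(d_1^{(n)},\dots,d_n^{(n)})$ be a sequence of non-negative integers such that $\sum_i d_i$ is even for all large $n$, and assume that, as $n\to\infty$, $$\sum_{i=1}^n d_i=\Theta(n)\quad\text{and}\quad \sum_{i=1}^n d_i^2=O(n),$$ with no further bound on the maximum degree. Let $G(n,\mathbf d)$ be uniformly random among the simple graphs on $[n]$ in which vertex $i$ has degree $d_i$. Let the switched graph $\widehat G(n,\mathbf d)$ be constructed as follows. Give each vertex $i$ a set of $d_i$ half-edges, and choose a uniformly random perfect matching (configuration) of all half-edges; each matched pair is an edge. An edge is bad if it is a loop or is parallel to another edge. As long as there is a bad edge, choose a bad edge $\{a,b\}$ (with half-edges $a,b$) by a given rule, choose another edge uniformly at random among all other edges of the current configuration, order its two half-edges randomly as $(c,e)$, and replace the edges $\{a,b\},\{c,e\}$ by $\{a,e\},\{c,b\}$. When no bad edge is left, the configuration defines a simple graph, which is $\widehat G(n,\mathbf d)$; if the process does not terminate, it is restarted with a new random configuration. The rule may be arbitrary for each $n$; it may be random and may depend on the history of the process. Then, for all large $n$, both random graphs are well defined, and, as $n\to\infty$,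 $\widehat G(n,\mathbf d)$ and $G(n,\mathbf d)$ are contiguous: for every sequence of sets $\mathcal E_n$ of simple graphs on $[n]$, $$\mathbb P\bigl(\widehat G(n,\mathbf d)\in\mathcal E_n\bigr)\to0\iff \mathbb P\bigl(G(n,\mathbf d)\in\mathcal E_n\bigr)\to0.$$ In other words, a sequence of events holds with high probability (with probability tending to $1$) for $\widehat G(n,\mathbf d)$ if and only if it does for $G(n,\mathbf d)$. -/

import Mathlib

open MeasureTheory Filter Topology Asymptotics
open scoped ENNReal

namespace SwitchedGraph

/-- The half-edges of a degree sequence `d`: the vertex `i` has `d i` of them. -/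
abbrev HalfEdge {n : ℕ} (d : Fin n → ℕ) : Type := Σ i : Fin n, Fin (d i)

/-- A configuration: a perfect matching of the half-edges, given by the map `mate` that takes
every half-edge to the half-edge it is paired with. -/
@[ext]
structure Configuration {n : ℕ} (d : Fin n → ℕ) where
  mate : HalfEdge d → HalfEdge d
  mate_mate : ∀ h, mate (mate h) = h
  mate_ne : ∀ h, mate h ≠ h

namespace Configuration

variable {n : ℕ} {d : Fin n → ℕ}

instance : Finite (Configuration d) :=
  Finite.of_injective (fun σ : Configuration d => σ.mate) fun _ _ h => Configuration.ext h

noncomputable instance : Fintype (Configuration d) := Fintype.ofFinite _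

/-- The endpoints of the edge `{h, mate h}` of the configuration. -/
def endpoints (σ : Configuration d) (h : HalfEdge d) : Sym2 (Fin n) := s(h.1, (σ.mate h).1)

/-- The edge `{h, mate h}` is bad: it is a loop, or it is parallel to another edge. -/
def IsBad (σ : Configuration d) (h : HalfEdge d) : Prop :=
  (σ.endpoints h).IsDiag ∨ ∃ h', h' ≠ h ∧ h' ≠ σ.mate h ∧ σ.endpoints h' = σ.endpoints h

/-- A configuration is simple if it has no bad edge. -/
def IsSimple (σ : Configuration d) : Prop := ¬ ∃ h, σ.IsBad h

/-- The graph on the vertices to which a simple configuration projects. (For other configurations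
the loops are dropped and parallel edges are merged; this case is not used.) -/
def toGraph (σ : Configuration d) : SimpleGraph (Fin n) where
  Adj i j := i ≠ j ∧ ∃ h, h.1 = i ∧ (σ.mate h).1 = j
  symm := ⟨by
    rintro i j ⟨hij, h, h1, h2⟩
    exact ⟨hij.symm, σ.mate h, h2, by rw [σ.mate_mate]; exact h1⟩⟩
  loopless := ⟨fun _ h => h.1 rfl⟩

/-- The half-edges that do not belong to the edge `{b, mate b}`. -/
abbrev Other (σ : Configuration d) (b : HalfEdge d) : Type :=
  {h : HalfEdge d // h ≠ b ∧ h ≠ σ.mate b}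

noncomputable instance (σ : Configuration d) (b : HalfEdge d) : Fintype (σ.Other b) :=
  Fintype.ofFinite _

/-- The switching of the edges `{b, mate b}` and `{h, mate h}`: they are replaced by
`{b, mate h}` and `{h, mate b}`. -/
def switch (σ : Configuration d) (b : HalfEdge d) (h : σ.Other b) : Configuration d where
  mate x :=
    if x = b then σ.mate h.1
    else if x = σ.mate h.1 then b
    else if x = h.1 then σ.mate b
    else if x = σ.mate b then h.1
    else σ.mate x
  mate_mate := by
    obtain ⟨h, hb, hb'⟩ := h
    have h1 := σ.mate_mate
    have h2 := σ.mate_ne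
    intro x
    grind
  mate_ne := by
    obtain ⟨h, hb, hb'⟩ := h
    have h1 := σ.mate_mate
    have h2 := σ.mate_ne
    intro x
    grind

end Configuration

/-- The state of the switching process: the current configuration, and the list of the earlier
configurations, each with the half-edges `b` and `h` that were used to switch its edges
`{b, mate b}` (bad) and `{h, mate h}` (the additional edge). -/
structure State {n : ℕ} (d : Fin n → ℕ) where
  current : Configuration d
  past : List (Configuration d × HalfEdge d × HalfEdge d)

/-- A rule for choosing the bad edge to switch, whenever there is one. The choice may be random,
and it may depend on the whole history of the process. The bad edge is given by one of its two
half-edges; which of the two does not influence the law of the switching, since the half-edges of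
the additional edge are ordered at random. -/
abbrev Rule {n : ℕ} (d : Fin n → ℕ) : Type :=
  (s : State d) → (∃ b, s.current.IsBad b) → PMF {b : HalfEdge d // s.current.IsBad b}

variable {n : ℕ} {d : Fin n → ℕ}

open Classical in
/-- One step of the process. If there is a bad edge, one is chosen by the rule and it is switched
with a uniformly random other edge, the half-edges of which are ordered at random; equivalently,
a half-edge outside the bad edge is drawn uniformly. A simple configuration is left as it is.
(So is one whose only edge is bad; then the process never terminates.) -/
noncomputable def step (rule : Rule d) (s : State d) : PMF (State d) :=
  if hs : ∃ b, s.current.IsBad b then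
    (rule s hs).bind fun b =>
      if _ho : Nonempty (s.current.Other b.1) then
        (PMF.uniformOfFintype (s.current.Other b.1)).map fun h =>
          ⟨s.current.switch b.1 h, (s.current, b.1, h.1) :: s.past⟩
      else PMF.pure s
  else PMF.pure s

/-- The law of the state after `k` steps, for the initial configuration `σ`. -/
noncomputable def run (rule : Rule d) (σ : Configuration d) : ℕ → PMF (State d)
  | 0 => PMF.pure ⟨σ, []⟩
  | k + 1 => (run rule σ k).bind (step rule)

open Classical in
/-- The simple graph that the process has produced, if it has terminated. -/
noncomputable def State.result (s : State d) : Option (SimpleGraph (Fin n)) :=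
  if s.current.IsSimple then some s.current.toGraph else none

/-- The probability that the process, started at a uniformly random configuration, has terminated
with the simple graph `G` after at most `k` switchings. -/
noncomputable def resultProb (rule : Rule d) (k : ℕ) (G : SimpleGraph (Fin n)) : ℝ≥0∞ :=
  (∑ σ : Configuration d, ((run rule σ k).map State.result) (some G)) /
    Fintype.card (Configuration d)

open Classical in
/-- The law of the result of the process, on the event that it terminates. The mass of a graph
`G` is the probability that the process ever terminates with `G` (`resultProb rule k G` is
nondecreasing in `k`), and the total mass is the probability that the process terminates. -/
noncomputable def terminalMeasure (rule : Rule d) : Measure (SimpleGraph (Fin n)) :=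
  ∑ G : SimpleGraph (Fin n), (⨆ k, resultProb rule k G) • Measure.dirac G

/-- The law of the switched graph `Ĝ(n, d)`. A process that does not terminate is restarted with a
new random configuration, so this is the law of the result given that the process terminates. -/
noncomputable def switchedLaw (rule : Rule d) : Measure (SimpleGraph (Fin n)) :=
  (terminalMeasure rule Set.univ)⁻¹ • terminalMeasure rule

open Classical in
/-- The simple graphs on `Fin n` in which the vertex `i` has degree `d i`. -/
def graphsWithDegrees {n : ℕ} (d : Fin n → ℕ) : Set (SimpleGraph (Fin n)) :=
  {G | ∀ i, G.degree i = d i}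

/-- The law of `G(n, d)`: the uniform distribution on the simple graphs with degrees `d`. -/
noncomputable def uniformLaw {n : ℕ} (d : Fin n → ℕ) : Measure (SimpleGraph (Fin n)) :=
  ProbabilityTheory.uniformOn (graphsWithDegrees d)

/-- Contiguity of two sequences of laws. -/
def Contiguous {S : ℕ → Type*} [∀ n, MeasurableSpace (S n)] (μ ν : ∀ n, Measure (S n)) : Prop :=
  ∀ E : ∀ n, Set (S n), (∀ n, MeasurableSet (E n)) →
    (Tendsto (fun n => μ n (E n)) atTop (𝓝 0) ↔ Tendsto (fun n => ν n (E n)) atTop (𝓝 0))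

/-- The events `E n` hold with high probability, i.e. with probability tending to `1`. -/
def HoldsWhp {S : ℕ → Type*} [∀ n, MeasurableSpace (S n)] (μ : ∀ n, Measure (S n))
    (E : ∀ n, Set (S n)) : Prop :=
  Tendsto (fun n => μ n (E n)) atTop (𝓝 1)

end SwitchedGraph

namespace SwitchedGraph

/-! Write N for the number of half-edges; `sqSum d` is O(N).

One half of the contiguity is soft. A simple initial configuration is never switched, and given
simplicity its graph is uniform, since every graph with degrees `d` comes from the same number of
simple configurations (`card_toGraph_eq`). So the law of the result dominates `simpleProb d *
uniformLaw d`, and it remains to bound `simpleProb d` from below.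

For the other half, the process is stopped at a constant time K. Apart from an event of small
probability, the configuration then has bounded density with respect to the uniform one, and it is
simple. The density is controlled by counting backwards. Whatever the rule, a given switching of a
given bad edge has probability at most of order 1/N, so what matters is the number of switchings
into a configuration σ that switch a bad edge. It is at most `2 * sqSum d + σ.weight`
(`card_preimages_le`). The weight is typically O(N) and a switching changes it by O(N), so each step
costs a constant factor (`sum_branch_le`). For the termination, the number of bad edges has bounded
mean, and a switching removes a bad edge without creating one unless the drawn half-edge is among
`badCount` + O(N^(3/4)) exceptional ones (`card_exceptional_le`).

Both estimates are combined in `exists_bound`. Applied to the event of all graphs, it also bounds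
`simpleProb d` from below: almost all mass ends in simple configurations and the density is bounded,
so these cannot be rare. -/

/-! ### Expectations with respect to a probability mass function -/

/-- The expectation of a function with values in `ℝ≥0∞`. -/
noncomputable def expect {α : Type*} (p : PMF α) (f : α → ℝ≥0∞) : ℝ≥0∞ := ∑' a, p a * f a

section Expect

variable {α β : Type*}

lemma expect_pure (a : α) (f : α → ℝ≥0∞) : expect (PMF.pure a) f = f a := by
  rw [expect, tsum_eq_single a]
  · simp
  · intro b hb
    simp [PMF.pure_apply, hb]

lemma expect_bind (p : PMF α) (q : α → PMF β) (f : β → ℝ≥0∞) :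
    expect (p.bind q) f = expect p fun a => expect (q a) f := by
  simp only [expect, PMF.bind_apply, ← ENNReal.tsum_mul_right, ← ENNReal.tsum_mul_left]
  rw [ENNReal.tsum_comm]
  simp only [mul_assoc]

lemma expect_map (p : PMF α) (g : α → β) (f : β → ℝ≥0∞) :
    expect (p.map g) f = expect p (f ∘ g) := by
  rw [PMF.map, expect_bind]
  simp only [Function.comp_apply, expect_pure]
  rfl

lemma expect_mono (p : PMF α) {f g : α → ℝ≥0∞} (h : ∀ a, f a ≤ g a) :
    expect p f ≤ expect p g :=
  ENNReal.tsum_le_tsum fun a => mul_le_mul_right (h a) _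

lemma expect_const (p : PMF α) (c : ℝ≥0∞) : expect p (fun _ => c) = c := by
  rw [expect, ENNReal.tsum_mul_right, p.tsum_coe, one_mul]

lemma expect_add (p : PMF α) (f g : α → ℝ≥0∞) :
    expect p (fun a => f a + g a) = expect p f + expect p g := by
  simp only [expect, mul_add, ENNReal.tsum_add]

lemma expect_finsetSum {ι : Type*} (p : PMF α) (s : Finset ι) (f : ι → α → ℝ≥0∞) :
    expect p (fun a => ∑ i ∈ s, f i a) = ∑ i ∈ s, expect p (f i) := by
  classical
  induction s using Finset.induction_on with
  | empty => simp [expect]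
  | insert i s hi ih => simp only [Finset.sum_insert hi, expect_add, ih]

lemma expect_le_sum [Fintype α] (p : PMF α) (f : α → ℝ≥0∞) : expect p f ≤ ∑ a, f a := by
  rw [expect, tsum_fintype]
  exact Finset.sum_le_sum fun a _ => mul_le_of_le_one_left (zero_le) (p.coe_le_one a)

lemma expect_uniformOfFintype [Fintype α] [Nonempty α] (f : α → ℝ≥0∞) :
    expect (PMF.uniformOfFintype α) f = (∑ a, f a) / Fintype.card α := by
  rw [expect, tsum_fintype, ENNReal.div_eq_inv_mul, Finset.mul_sum]
  simp

lemma map_apply_eq_expect [DecidableEq β] (p : PMF α) (g : α → β) (b : β) :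
    (p.map g) b = expect p fun a => if g a = b then 1 else 0 := by
  rw [PMF.map_apply, expect]
  refine tsum_congr fun a => ?_
  by_cases h : g a = b
  · simp [h]
  · rw [if_neg (fun h' => h h'.symm), if_neg h, mul_zero]

end Expect

end SwitchedGraph

namespace SwitchedGraph

variable {n : ℕ} {d : Fin n → ℕ}

/-! ### Sums over half-edges -/

/-- The sum of the squares of the degrees. -/
def sqSum (d : Fin n → ℕ) : ℕ := ∑ i, d i ^ 2

lemma card_halfEdge : Fintype.card (HalfEdge d) = ∑ i, d i := by
  rw [Fintype.card_sigma]; simp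

lemma sum_fst (f : Fin n → ℕ) : ∑ x : HalfEdge d, f x.1 = ∑ i, d i * f i := by
  rw [Fintype.sum_sigma]; simp

lemma sum_fst_eq (i : Fin n) : ∑ x : HalfEdge d, (if x.1 = i then 1 else 0) = d i := by
  rw [sum_fst fun j => if j = i then 1 else 0]
  simp

lemma sum_fst_eq' (i : Fin n) : ∑ x : HalfEdge d, (if i = x.1 then 1 else 0) = d i := by
  simpa only [eq_comm] using sum_fst_eq (d := d) i

lemma sum_degree : ∑ x : HalfEdge d, d x.1 = sqSum d := by
  rw [sum_fst, sqSum]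
  exact Finset.sum_congr rfl fun i _ => (sq (d i)).symm

lemma card_le_sqSum : Fintype.card (HalfEdge d) ≤ sqSum d := by
  rw [card_halfEdge, sqSum]
  exact Finset.sum_le_sum fun i _ => Nat.le_self_pow two_ne_zero _

lemma sq_le_sqSum (i : Fin n) : d i ^ 2 ≤ sqSum d :=
  Finset.single_le_sum (f := fun i => d i ^ 2) (fun _ _ => Nat.zero_le _) (Finset.mem_univ i)

lemma mul_le_sqSum (i j : Fin n) : d i * d j ≤ sqSum d := by
  have h1 := sq_le_sqSum (d := d) i
  have h2 := sq_le_sqSum (d := d) j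
  nlinarith [Nat.le_total (d i) (d j)]

/-- The weight of a pair of half-edges that is used to control the number of preimages
under switchings. -/
def pairWeight (x y : HalfEdge d) : ℕ :=
  d x.1 * d y.1 + if x.1 = y.1 then Fintype.card (HalfEdge d) else 0

lemma pairWeight_le (x y : HalfEdge d) : pairWeight x y ≤ 2 * sqSum d := by
  have h1 := mul_le_sqSum (d := d) x.1 y.1
  have h2 := card_le_sqSum (d := d)
  unfold pairWeight
  split_ifs <;> omega

lemma sum_pairWeight : ∑ x : HalfEdge d, ∑ y, pairWeight x y =
    sqSum d ^ 2 + Fintype.card (HalfEdge d) * sqSum d := by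
  have h : ∀ x : HalfEdge d, ∑ y : HalfEdge d, pairWeight x y =
      d x.1 * sqSum d + d x.1 * Fintype.card (HalfEdge d) := by
    intro x
    simp only [pairWeight, Finset.sum_add_distrib, ← Finset.mul_sum, sum_degree]
    congr 1
    have := sum_fst_eq' (d := d) x.1
    rw [← this, Finset.sum_mul]
    exact Finset.sum_congr rfl fun y _ => by split_ifs <;> simp
  simp only [h, Finset.sum_add_distrib, ← Finset.sum_mul, sum_degree]
  ring

namespace Configuration

/-! ### Bad edges and switchings -/

/-- A configuration as a permutation of the half-edges. -/
def toPerm (σ : Configuration d) : Equiv.Perm (HalfEdge d) :=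
  ⟨σ.mate, σ.mate, σ.mate_mate, σ.mate_mate⟩

lemma sum_mate {M : Type*} [AddCommMonoid M] (σ : Configuration d) (f : HalfEdge d → M) :
    ∑ x, f (σ.mate x) = ∑ x, f x :=
  Equiv.sum_comp σ.toPerm f

lemma isBad_iff (σ : Configuration d) (b : HalfEdge d) :
    σ.IsBad b ↔ b.1 = (σ.mate b).1 ∨
      ∃ x, x ≠ b ∧ x ≠ σ.mate b ∧ x.1 = b.1 ∧ (σ.mate x).1 = (σ.mate b).1 := by
  unfold IsBad endpoints
  rw [Sym2.mk_isDiag_iff]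
  refine or_congr Iff.rfl ⟨?_, ?_⟩
  · rintro ⟨x, hb, hm, he⟩
    rw [Sym2.eq_iff] at he
    rcases he with he | he
    · exact ⟨x, hb, hm, he⟩
    · refine ⟨σ.mate x, ?_, ?_, he.2, ?_⟩
      · intro h; apply hm; rw [← h, σ.mate_mate]
      · intro h; apply hb; rw [← σ.mate_mate x, h, σ.mate_mate]
      · rw [σ.mate_mate]; exact he.1
  · rintro ⟨x, hb, hm, h1, h2⟩
    exact ⟨x, hb, hm, by rw [h1, h2]⟩

lemma isBad_mate (σ : Configuration d) (b : HalfEdge d) :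
    σ.IsBad (σ.mate b) ↔ σ.IsBad b := by
  unfold IsBad endpoints
  rw [σ.mate_mate, Sym2.eq_swap]
  simp only [and_left_comm]

open Classical in
/-- The switching of the edges of `b` and `h`, which does nothing if these are the same edge. -/
noncomputable def switchAt (σ : Configuration d) (b h : HalfEdge d) : Configuration d :=
  if hh : h ≠ b ∧ h ≠ σ.mate b then σ.switch b ⟨h, hh⟩ else σ

lemma switch_eq_switchAt (σ : Configuration d) (b : HalfEdge d) (h : σ.Other b) :
    σ.switch b h = σ.switchAt b h.1 := by
  rw [switchAt, dif_pos h.2]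

lemma switchAt_mate (σ : Configuration d) {b h : HalfEdge d} (hb : h ≠ b) (hm : h ≠ σ.mate b)
    (x : HalfEdge d) : (σ.switchAt b h).mate x =
      if x = b then σ.mate h else if x = σ.mate h then b else if x = h then σ.mate b
      else if x = σ.mate b then h else σ.mate x := by
  rw [switchAt, dif_pos ⟨hb, hm⟩]
  rfl

/-- After the switching, `b` is matched with `σ.mate h` and `h` with `σ.mate b`, so the same pair
`b`, `h` undoes it. Hence reverse switchings are again switchings, with the same labels. -/
lemma switchAt_switchAt (σ : Configuration d) (b h : HalfEdge d) :
    (σ.switchAt b h).switchAt b h = σ := by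
  by_cases hh : h ≠ b ∧ h ≠ σ.mate b
  · have h1 : h ≠ (σ.switchAt b h).mate b := by
      rw [switchAt_mate σ hh.1 hh.2, if_pos rfl]
      exact (σ.mate_ne h).symm
    ext1
    funext x
    rw [switchAt_mate _ hh.1 h1]
    simp only [switchAt_mate σ hh.1 hh.2]
    have h2 := σ.mate_mate
    have h3 := σ.mate_ne
    grind
  · have h1 : σ.switchAt b h = σ := dif_neg hh
    rw [h1, h1]

/-- The switching of the edges of two given half-edges, as a permutation of the configurations. -/
noncomputable def switchPerm (b h : HalfEdge d) : Equiv.Perm (Configuration d) :=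
  ⟨fun σ => σ.switchAt b h, fun σ => σ.switchAt b h, fun σ => σ.switchAt_switchAt b h,
    fun σ => σ.switchAt_switchAt b h⟩

lemma other_switchAt_iff (σ : Configuration d) (b h : HalfEdge d) :
    (h ≠ b ∧ h ≠ (σ.switchAt b h).mate b) ↔ h ≠ b ∧ h ≠ σ.mate b := by
  by_cases hh : h ≠ b ∧ h ≠ σ.mate b
  · refine iff_of_true ⟨hh.1, ?_⟩ hh
    rw [switchAt_mate σ hh.1 hh.2, if_pos rfl]
    exact (σ.mate_ne h).symm
  · have h1 : σ.switchAt b h = σ := dif_neg hh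
    rw [h1]

/-- The total weight of the edges of a configuration (every edge is counted twice). -/
def weight (σ : Configuration d) : ℕ := ∑ x, pairWeight x (σ.mate x)

/-- Only the four half-edges of the two edges get new mates, and each pair weighs at most `2 * sqSum
d`. -/
lemma weight_switchAt_le (σ : Configuration d) (b h : HalfEdge d) :
    (σ.switchAt b h).weight ≤ σ.weight + 8 * sqSum d := by
  by_cases hh : h ≠ b ∧ h ≠ σ.mate b
  · have hle : ∀ x, pairWeight x ((σ.switchAt b h).mate x) ≤ pairWeight x (σ.mate x) +
        if x ∈ ({b, σ.mate h, h, σ.mate b} : Finset (HalfEdge d)) then 2 * sqSum d else 0 := by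
      intro x
      split_ifs with hx
      · exact (pairWeight_le _ _).trans (Nat.le_add_left _ _)
      · simp only [Finset.mem_insert, Finset.mem_singleton, not_or] at hx
        rw [switchAt_mate σ hh.1 hh.2, if_neg hx.1, if_neg hx.2.1, if_neg hx.2.2.1,
          if_neg hx.2.2.2]
        exact le_rfl
    refine (Finset.sum_le_sum fun x _ => hle x).trans ?_
    rw [Finset.sum_add_distrib, ← Finset.sum_filter, Finset.sum_const, smul_eq_mul]
    have hc : (Finset.univ.filter
        (· ∈ ({b, σ.mate h, h, σ.mate b} : Finset (HalfEdge d)))).card ≤ 4 := by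
      rw [Finset.filter_mem_eq_inter, Finset.univ_inter]
      exact Finset.card_le_four
    have := Nat.mul_le_mul_right (2 * sqSum d) hc
    unfold weight
    omega
  · have h1 : σ.switchAt b h = σ := dif_neg hh
    rw [h1]
    exact Nat.le_add_right _ _

/-- The new edge at `b` is a loop, or parallel to the other new edge in one of the two orientations,
or parallel to an old edge. For the other new edge only one of the two coincidences of vertices is
kept; this is enough for the count. -/
lemma isBad_switchAt_cases (σ : Configuration d) {b h : HalfEdge d} (hb : h ≠ b)
    (hm : h ≠ σ.mate b) (hbad : (σ.switchAt b h).IsBad b) :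
    b.1 = (σ.mate h).1 ∨ h.1 = b.1 ∨ h.1 = (σ.mate h).1 ∨
      ∃ x, x.1 = b.1 ∧ (σ.mate x).1 = (σ.mate h).1 := by
  rw [isBad_iff] at hbad
  simp only [switchAt_mate σ hb hm, if_true] at hbad
  rcases hbad with hbad | ⟨x, hx1, hx2, hx3, hx4⟩
  · exact Or.inl hbad
  · rw [if_neg hx1, if_neg hx2] at hx4
    split_ifs at hx4 with h1 h2
    · exact Or.inr (Or.inl (h1 ▸ hx3))
    · exact Or.inr (Or.inr (Or.inl hx4))
    · exact Or.inr (Or.inr (Or.inr ⟨x, hx3, hx4⟩))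

open Classical in
/-- The number of switchings that lead to `σ` and switch a bad edge. -/
lemma card_preimages_le (σ : Configuration d) :
    ∑ b : HalfEdge d, ∑ h : HalfEdge d,
      (if (h ≠ b ∧ h ≠ σ.mate b) ∧ (σ.switchAt b h).IsBad b then 1 else 0) ≤
      2 * sqSum d + σ.weight := by
  -- A union bound over the four cases of `isBad_switchAt_cases`, with a sum over the half-edge `x`
  -- of the last one.
  have hle : ∀ b h : HalfEdge d,
      (if (h ≠ b ∧ h ≠ σ.mate b) ∧ (σ.switchAt b h).IsBad b then 1 else 0) ≤
      (if b.1 = (σ.mate h).1 then 1 else 0) + (if h.1 = b.1 then 1 else 0) +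
      (if h.1 = (σ.mate h).1 then 1 else 0) +
      ∑ x, (if x.1 = b.1 then 1 else 0) * (if (σ.mate x).1 = (σ.mate h).1 then 1 else 0) := by
    intro b h
    by_cases h0 : (h ≠ b ∧ h ≠ σ.mate b) ∧ (σ.switchAt b h).IsBad b
    · rw [if_pos h0]
      rcases isBad_switchAt_cases σ h0.1.1 h0.1.2 h0.2 with h1 | h1 | h1 | ⟨x, h1, h2⟩
      · rw [if_pos h1]; omega
      · rw [if_pos h1]; omega
      · rw [if_pos h1]; omega
      · have := Finset.single_le_sum (f := fun x : HalfEdge d =>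
          (if x.1 = b.1 then 1 else 0) * (if (σ.mate x).1 = (σ.mate h).1 then 1 else 0))
          (fun _ _ => Nat.zero_le _) (Finset.mem_univ x)
        simp only [h1, h2, if_true, mul_one] at this
        omega
    · rw [if_neg h0]
      exact Nat.zero_le _
  refine (Finset.sum_le_sum fun b _ => Finset.sum_le_sum fun h _ => hle b h).trans ?_
  simp only [Finset.sum_add_distrib]
  have e1 : ∑ b : HalfEdge d, ∑ h : HalfEdge d, (if b.1 = (σ.mate h).1 then 1 else 0) =
      sqSum d := by
    rw [← sum_degree]
    refine Finset.sum_congr rfl fun b _ => ?_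
    rw [σ.sum_mate fun h => if b.1 = h.1 then 1 else 0, sum_fst_eq']
  have e2 : ∑ b : HalfEdge d, ∑ h : HalfEdge d, (if h.1 = b.1 then 1 else 0) = sqSum d := by
    rw [← sum_degree]
    exact Finset.sum_congr rfl fun b _ => sum_fst_eq _
  have e3 : ∑ _b : HalfEdge d, ∑ h : HalfEdge d, (if h.1 = (σ.mate h).1 then 1 else 0) =
      ∑ h : HalfEdge d, if h.1 = (σ.mate h).1 then Fintype.card (HalfEdge d) else 0 := by
    rw [Finset.sum_const, Finset.card_univ, smul_eq_mul, Finset.mul_sum]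
    exact Finset.sum_congr rfl fun b _ => by split_ifs <;> simp
  have e4 : ∑ b : HalfEdge d, ∑ h : HalfEdge d, ∑ x : HalfEdge d,
      (if x.1 = b.1 then 1 else 0) * (if (σ.mate x).1 = (σ.mate h).1 then 1 else 0) =
      ∑ x : HalfEdge d, d x.1 * d (σ.mate x).1 := by
    simp_rw [Finset.sum_comm (s := (Finset.univ : Finset (HalfEdge d))) (t := Finset.univ)
      (f := fun h x : HalfEdge d => (if x.1 = _ then 1 else 0) *
        (if (σ.mate x).1 = (σ.mate h).1 then 1 else 0)), ← Finset.mul_sum]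
    rw [Finset.sum_comm]
    refine Finset.sum_congr rfl fun x _ => ?_
    rw [← Finset.sum_mul, sum_fst_eq', σ.sum_mate fun h => if (σ.mate x).1 = h.1 then 1 else 0,
      sum_fst_eq']
  rw [e1, e2, e3, e4]
  -- The two summands of `pairWeight` are made to match `e4` (old edges that get a parallel one) and
  -- `e3` (loops, for which `b` is arbitrary).
  simp only [weight, pairWeight, Finset.sum_add_distrib]
  omega

/-! ### Switchings that create new bad edges -/

/-- The vertices of the two half-edges are adjacent. -/
def Adjacent (σ : Configuration d) (x y : HalfEdge d) : Prop :=
  ∃ z, z.1 = x.1 ∧ (σ.mate z).1 = y.1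

/-- The switchings of the edges of `b` and `h` that may create a new bad edge. -/
def Exceptional (σ : Configuration d) (b h : HalfEdge d) : Prop :=
  h.1 = (σ.mate h).1 ∨ h.1 = b.1 ∨ (σ.mate h).1 = b.1 ∨ h.1 = (σ.mate b).1 ∨
    σ.Adjacent b (σ.mate h) ∨ σ.Adjacent (σ.mate b) h

/-- The excluded coincidences are those that could make one of the two new edges a loop or parallel
to another edge. With both new edges good, a bad edge is an old one, and so is any edge parallel to
it. -/
lemma IsBad.of_switchAt {σ : Configuration d} {b h : HalfEdge d} (hb : h ≠ b)
    (hm : h ≠ σ.mate b) (he : ¬ σ.Exceptional b h) {x : HalfEdge d}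
    (hx : (σ.switchAt b h).IsBad x) : σ.IsBad x ∧ x ≠ b := by
  simp only [Exceptional, Adjacent, not_or, not_exists, not_and] at he
  obtain ⟨he1, he2, he3, he4, he5, he6⟩ := he
  have hτ := switchAt_mate σ hb hm
  have mm := σ.mate_mate
  have mn := σ.mate_ne
  have hb' : ¬ (σ.switchAt b h).IsBad b := by
    rw [isBad_iff]
    simp only [hτ, if_true]
    rintro (h1 | ⟨y, h1, h2, h3, h4⟩)
    · exact he3 h1.symm
    · rw [if_neg h1, if_neg h2] at h4
      split_ifs at h4 with h5 h6
      · exact he2 (h5 ▸ h3)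
      · exact he1 h4
      · exact he5 y h3 h4
  have hh' : ¬ (σ.switchAt b h).IsBad h := by
    have hτh : (σ.switchAt b h).mate h = σ.mate b := by
      rw [hτ, if_neg hb, if_neg (mn h).symm, if_pos rfl]
    rw [isBad_iff, hτh]
    simp only [hτ]
    rintro (h1 | ⟨y, h1, h2, h3, h4⟩)
    · exact he4 h1
    · split_ifs at h4 with h5 h6
      · exact he2 (h5 ▸ h3).symm
      · exact he1 (h6 ▸ h3).symm
      · exact he6 (σ.mate y) h4 (by rw [mm]; exact h3)
  have hσh : (σ.switchAt b h).mate b = σ.mate h := by rw [hτ, if_pos rfl]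
  have hσb : (σ.switchAt b h).mate h = σ.mate b := by
    rw [hτ, if_neg hb, if_neg (mn h).symm, if_pos rfl]
  have hbm : ¬ (σ.switchAt b h).IsBad (σ.mate h) := by rwa [← hσh, isBad_mate]
  have hhm : ¬ (σ.switchAt b h).IsBad (σ.mate b) := by rwa [← hσb, isBad_mate]
  -- The four half-edges with new mates are not bad, so a bad half-edge has its old mate.
  have hne : ∀ z, (σ.switchAt b h).IsBad z → (σ.switchAt b h).mate z = σ.mate z := by
    intro z hz
    rw [hτ, if_neg, if_neg, if_neg, if_neg]
    · rintro rfl; exact hhm hz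
    · rintro rfl; exact hh' hz
    · rintro rfl; exact hbm hz
    · rintro rfl; exact hb' hz
  refine ⟨?_, fun h0 => hb' (h0 ▸ hx)⟩
  have hx0 := hx
  rw [isBad_iff] at hx ⊢
  rw [hne x hx0] at hx
  refine hx.imp id ?_
  rintro ⟨y, h1, h2, h3, h4⟩
  refine ⟨y, h1, h2, h3, ?_⟩
  rwa [hne y] at h4
  -- `hne` applies to `y` as well: `y` is itself bad, being parallel to `x`.
  rw [isBad_iff]
  refine Or.inr ⟨x, h1.symm, ?_, h3.symm, by rw [hne x hx0, h4]⟩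
  intro h5
  apply h2
  rw [← hne x hx0, h5, mate_mate]

open Classical in
/-- The number of half-edges of bad edges. -/
noncomputable def badCount (σ : Configuration d) : ℕ := (Finset.univ.filter σ.IsBad).card

lemma badCount_eq_zero_iff (σ : Configuration d) : σ.badCount = 0 ↔ σ.IsSimple := by
  simp only [badCount, IsSimple, Finset.card_eq_zero, Finset.filter_eq_empty_iff,
    Finset.mem_univ, true_implies, not_exists]

lemma badCount_switchAt_lt {σ : Configuration d} {b h : HalfEdge d} (hbad : σ.IsBad b)
    (hb : h ≠ b) (hm : h ≠ σ.mate b) (he : ¬ σ.Exceptional b h) :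
    (σ.switchAt b h).badCount < σ.badCount := by
  classical
  refine Finset.card_lt_card ((Finset.ssubset_iff_of_subset ?_).2 ⟨b, ?_, ?_⟩)
  · intro x
    simp only [Finset.mem_filter_univ]
    exact fun hx => (hx.of_switchAt hb hm he).1
  · simpa using hbad
  · simp only [Finset.mem_filter_univ]
    exact fun hx => (hx.of_switchAt hb hm he).2 rfl

/-! ### Counting the exceptional switchings. -/

lemma card_filter_fst_eq (i : Fin n) :
    (Finset.univ.filter fun x : HalfEdge d => x.1 = i).card = d i := by
  rw [Finset.card_filter]
  exact sum_fst_eq i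

lemma card_filter_mate (σ : Configuration d) (p : HalfEdge d → Prop) [DecidablePred p] :
    (Finset.univ.filter fun x => p (σ.mate x)).card = (Finset.univ.filter p).card := by
  rw [Finset.card_filter, Finset.card_filter]
  exact σ.sum_mate fun x => if p x then 1 else 0

open Classical in
-- The vertex of `x` has at most `d x.1` neighbours, so by Cauchy–Schwarz their degrees sum to at
-- most the square root of `d x.1 * sqSum d`; moreover `d x.1` is at most the square root of `sqSum
-- d`. The resulting exponent 3/4 is below 1, which is why no bound on the maximum degree is needed.
-- The fourth power keeps the estimate in ℕ.
lemma card_adjacent_pow_le (σ : Configuration d) (x : HalfEdge d) :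
    (Finset.univ.filter fun y => σ.Adjacent x y).card ^ 4 ≤ sqSum d ^ 3 := by
  set T : Finset (Fin n) := (Finset.univ.filter fun z : HalfEdge d => z.1 = x.1).image
    fun z => (σ.mate z).1 with hT
  have hTc : T.card ≤ d x.1 := by
    refine Finset.card_image_le.trans ?_
    rw [card_filter_fst_eq]
  have h1 : (Finset.univ.filter fun y => σ.Adjacent x y).card = ∑ i ∈ T, d i := by
    have : ∀ y : HalfEdge d, σ.Adjacent x y ↔ y.1 ∈ T := by
      intro y
      simp only [hT, Finset.mem_image, Finset.mem_filter_univ, Adjacent]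
    simp only [this]
    rw [Finset.card_filter, sum_fst fun i => if i ∈ T then 1 else 0]
    simp
  have h2 : (∑ i ∈ T, d i) ^ 2 ≤ d x.1 * sqSum d := by
    refine (sq_sum_le_card_mul_sum_sq (s := T) (f := d)).trans ?_
    refine Nat.mul_le_mul hTc ?_
    exact Finset.sum_le_sum_of_subset (Finset.subset_univ T)
  rw [h1]
  calc (∑ i ∈ T, d i) ^ 4 = ((∑ i ∈ T, d i) ^ 2) ^ 2 := by ring
    _ ≤ (d x.1 * sqSum d) ^ 2 := Nat.pow_le_pow_left h2 2
    _ = d x.1 ^ 2 * sqSum d ^ 2 := by ring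
    _ ≤ sqSum d * sqSum d ^ 2 := Nat.mul_le_mul_right _ (sq_le_sqSum _)
    _ = sqSum d ^ 3 := by ring

open Classical in
-- Loops are bad edges and are counted by `badCount`; each of the other five conditions holds for at
-- most `r` half-edges.
lemma card_exceptional_le (σ : Configuration d) (b : HalfEdge d) {r : ℕ}
    (hr : sqSum d ^ 3 ≤ r ^ 4) :
    (Finset.univ.filter fun h => σ.Exceptional b h).card ≤ σ.badCount + 5 * r := by
  have hd : ∀ x : HalfEdge d, d x.1 ≤ r := by
    intro x
    refine (Nat.pow_le_pow_iff_left (n := 4) (by norm_num)).1 (le_trans ?_ hr)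
    have h1 := sq_le_sqSum (d := d) x.1
    rcases Nat.eq_zero_or_pos (sqSum d) with h0 | h0
    · rw [h0] at h1
      have : d x.1 = 0 := by simpa using h1
      simp [this]
    · calc d x.1 ^ 4 = (d x.1 ^ 2) ^ 2 := by ring
        _ ≤ sqSum d ^ 2 := Nat.pow_le_pow_left h1 2
        _ ≤ sqSum d ^ 3 := Nat.pow_le_pow_right h0 (by norm_num)
  have ha : ∀ x : HalfEdge d, (Finset.univ.filter fun y => σ.Adjacent x y).card ≤ r := fun x =>
    (Nat.pow_le_pow_iff_left (n := 4) (by norm_num)).1 ((σ.card_adjacent_pow_le x).trans hr)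
  have hsub : (Finset.univ.filter fun h => σ.Exceptional b h) ⊆
      (Finset.univ.filter fun h => h.1 = (σ.mate h).1) ∪
      ((Finset.univ.filter fun h => h.1 = b.1) ∪
      ((Finset.univ.filter fun h => (σ.mate h).1 = b.1) ∪
      ((Finset.univ.filter fun h => h.1 = (σ.mate b).1) ∪
      ((Finset.univ.filter fun h => σ.Adjacent b (σ.mate h)) ∪
      (Finset.univ.filter fun h => σ.Adjacent (σ.mate b) h))))) := by
    intro h
    simp only [Finset.mem_union, Finset.mem_filter, Finset.mem_univ, true_and]
    exact fun hh => hh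
  refine (Finset.card_le_card hsub).trans ?_
  have c1 : (Finset.univ.filter fun h => h.1 = (σ.mate h).1).card ≤ σ.badCount := by
    refine Finset.card_le_card fun h hh => ?_
    simp only [Finset.mem_filter_univ] at hh ⊢
    rw [isBad_iff]
    exact Or.inl hh
  have c2 := (card_filter_fst_eq (d := d) b.1).trans_le (hd b)
  have c3 := (σ.card_filter_mate fun x => x.1 = b.1).trans_le
    ((card_filter_fst_eq (d := d) b.1).trans_le (hd b))
  have c4 := (card_filter_fst_eq (d := d) (σ.mate b).1).trans_le (hd (σ.mate b))
  have c5 := (σ.card_filter_mate fun x => σ.Adjacent b x).trans_le (ha b)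
  have c6 := ha (σ.mate b)
  refine (Finset.card_union_le _ _).trans (le_trans (Nat.add_le_add c1
    ((Finset.card_union_le _ _).trans (Nat.add_le_add c2
    ((Finset.card_union_le _ _).trans (Nat.add_le_add c3
    ((Finset.card_union_le _ _).trans (Nat.add_le_add c4
    ((Finset.card_union_le _ _).trans (Nat.add_le_add c5 c6))))))))) ?_)
  omega

end Configuration

/-! ### One step of the process -/

lemma Configuration.card_other (σ : Configuration d) (b : HalfEdge d) :
    Fintype.card (σ.Other b) = Fintype.card (HalfEdge d) - 2 := by
  rw [Fintype.card_of_subtype (Finset.univ \ {b, σ.mate b}) (by simp), Finset.card_sdiff_of_subset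
    (Finset.subset_univ _), Finset.card_pair (σ.mate_ne b).symm, Finset.card_univ]

lemma Configuration.nonempty_other (σ : Configuration d) (b : HalfEdge d)
    (hN : 2 < Fintype.card (HalfEdge d)) : Nonempty (σ.Other b) := by
  rw [← Fintype.card_pos_iff, σ.card_other]
  omega

open Classical in
lemma Configuration.sum_other {M : Type*} [AddCommMonoid M] (σ : Configuration d) (b : HalfEdge d)
    (f : HalfEdge d → M) : ∑ h : σ.Other b, f h.1 =
      ∑ h, if h ≠ b ∧ h ≠ σ.mate b then f h else 0 := by
  rw [← Finset.sum_filter]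
  exact (Finset.sum_subtype _ (by simp) f).symm

lemma expect_step_of_isSimple (rule : Rule d) {s : State d} (hs : s.current.IsSimple)
    (f : State d → ℝ≥0∞) : expect (step rule s) f = f s := by
  rw [step, dif_neg hs, expect_pure]

lemma expect_step_of_bad (rule : Rule d) {s : State d} (hs : ∃ b, s.current.IsBad b)
    (hN : 2 < Fintype.card (HalfEdge d)) (φ : Configuration d → ℝ≥0∞) :
    expect (step rule s) (fun t => φ t.current) = expect (rule s hs) fun b =>
      (∑ h : s.current.Other b.1, φ (s.current.switchAt b.1 h.1)) /
        ((Fintype.card (HalfEdge d) - 2 : ℕ) : ℝ≥0∞) := by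
  rw [step, dif_pos hs, expect_bind]
  congr 1
  funext b
  have := s.current.nonempty_other b.1 hN
  rw [dif_pos this, expect_map, expect_uniformOfFintype, s.current.card_other]
  simp only [Function.comp_def, Configuration.switch_eq_switchAt]

open Classical in
/-- An upper bound for the expectation of a function after one step of the process, whatever
the rule: the sum over all bad edges that may be switched. -/
noncomputable def branch (φ : Configuration d → ℝ≥0∞) (σ : Configuration d) : ℝ≥0∞ :=
  φ σ + ∑ b, ∑ h, if (h ≠ b ∧ h ≠ σ.mate b) ∧ σ.IsBad b then
    φ (σ.switchAt b h) / ((Fintype.card (HalfEdge d) - 2 : ℕ) : ℝ≥0∞) else 0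

/-- Bounding the probabilities of the rule by 1 removes all dependence on the rule and on the
history. The term `φ σ` of `branch` serves the simple configurations, which do not move. -/
lemma expect_step_le_branch (rule : Rule d) (hN : 2 < Fintype.card (HalfEdge d)) (s : State d)
    (φ : Configuration d → ℝ≥0∞) :
    expect (step rule s) (fun t => φ t.current) ≤ branch φ s.current := by
  classical
  by_cases hs : ∃ b, s.current.IsBad b
  · rw [expect_step_of_bad rule hs hN]
    refine (expect_le_sum _ _).trans (le_trans ?_ le_add_self)
    have h1 : ∀ b : {b : HalfEdge d // s.current.IsBad b},
        (∑ h : s.current.Other b.1, φ (s.current.switchAt b.1 h.1)) /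
          ((Fintype.card (HalfEdge d) - 2 : ℕ) : ℝ≥0∞) =
        ∑ h, if (h ≠ b.1 ∧ h ≠ s.current.mate b.1) ∧ s.current.IsBad b.1 then
          φ (s.current.switchAt b.1 h) / ((Fintype.card (HalfEdge d) - 2 : ℕ) : ℝ≥0∞) else 0 := by
      intro b
      rw [ENNReal.div_eq_inv_mul, Finset.mul_sum]
      simp only [← ENNReal.div_eq_inv_mul]
      rw [s.current.sum_other b.1 fun h => φ (s.current.switchAt b.1 h) /
        ((Fintype.card (HalfEdge d) - 2 : ℕ) : ℝ≥0∞)]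
      simp only [b.2, and_true]
    simp only [h1]
    rw [← Finset.sum_subtype (Finset.univ.filter s.current.IsBad) (by simp) (fun b : HalfEdge d =>
      ∑ h, if (h ≠ b ∧ h ≠ s.current.mate b) ∧ s.current.IsBad b then
          φ (s.current.switchAt b h) / ((Fintype.card (HalfEdge d) - 2 : ℕ) : ℝ≥0∞) else 0)]
    exact Finset.sum_le_sum_of_subset (Finset.subset_univ _)
  · rw [expect_step_of_isSimple rule hs]
    exact le_self_add

lemma expect_run_le_branch (rule : Rule d) (hN : 2 < Fintype.card (HalfEdge d))
    (σ : Configuration d) (k : ℕ) (φ : Configuration d → ℝ≥0∞) :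
    expect (run rule σ k) (fun t => φ t.current) ≤ branch^[k] φ σ := by
  induction k generalizing φ with
  | zero => rw [run, expect_pure]; rfl
  | succ k ih =>
    rw [run, expect_bind, Function.iterate_succ_apply]
    exact (expect_mono _ fun s => expect_step_le_branch rule hN s φ).trans (ih _)

/-! ### The density of the configuration after a bounded number of steps -/

open Classical in
-- For fixed `b` and `h`, the involution `switchPerm b h` turns the sum over the configuration
-- before the switching into a sum over the one after it. The coefficient of `φ τ` becomes the
-- number of switchings of bad edges into `τ`, divided by N - 2. The weight bound loosens from `m`
-- to `m + 8 * C`, as `τ` is one switching away.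
lemma sum_branch_le {C : ℕ} (hN : 4 ≤ Fintype.card (HalfEdge d))
    (hC : sqSum d ≤ C * Fintype.card (HalfEdge d)) (m : ℕ) (φ : Configuration d → ℝ≥0∞) :
    ∑ σ with σ.weight ≤ m * Fintype.card (HalfEdge d), branch φ σ ≤
      ((1 + 2 * (10 * C + m) : ℕ) : ℝ≥0∞) *
        ∑ τ with τ.weight ≤ (m + 8 * C) * Fintype.card (HalfEdge d), φ τ := by
  set N := Fintype.card (HalfEdge d) with hNdef
  have hw : ∀ τ : Configuration d, ∀ b h, (τ.switchAt b h).weight ≤ m * N →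
      τ.weight ≤ (m + 8 * C) * N := by
    intro τ b h h1
    have h2 := (τ.switchAt b h).weight_switchAt_le b h
    rw [Configuration.switchAt_switchAt] at h2
    nlinarith
  simp only [branch, Finset.sum_add_distrib, ← hNdef]
  rw [Nat.cast_add, add_mul, Nat.cast_one, one_mul]
  refine add_le_add ?_ ?_
  · refine Finset.sum_le_sum_of_subset fun σ => ?_
    simp only [Finset.mem_filter, Finset.mem_univ, true_and]
    intro h
    nlinarith
  · rw [Finset.sum_filter, Finset.sum_filter, Finset.mul_sum]
    have h1 : ∀ b h : HalfEdge d, ∑ σ : Configuration d, (if σ.weight ≤ m * N then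
        (if (h ≠ b ∧ h ≠ σ.mate b) ∧ σ.IsBad b then
          φ (σ.switchAt b h) / ((N - 2 : ℕ) : ℝ≥0∞) else 0) else 0) =
        ∑ τ : Configuration d, (if (τ.switchAt b h).weight ≤ m * N then
        (if (h ≠ b ∧ h ≠ τ.mate b) ∧ (τ.switchAt b h).IsBad b then
          φ τ / ((N - 2 : ℕ) : ℝ≥0∞) else 0) else 0) := by
      intro b h
      rw [← Equiv.sum_comp (Configuration.switchPerm b h)]
      refine Finset.sum_congr rfl fun τ _ => ?_
      change (if (τ.switchAt b h).weight ≤ m * N then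
        (if (h ≠ b ∧ h ≠ (τ.switchAt b h).mate b) ∧ (τ.switchAt b h).IsBad b then
          φ ((τ.switchAt b h).switchAt b h) / ((N - 2 : ℕ) : ℝ≥0∞) else 0) else 0) = _
      simp only [Configuration.other_switchAt_iff, Configuration.switchAt_switchAt]
    have h2 : ∀ σ : Configuration d, (if σ.weight ≤ m * N then ∑ b, ∑ h,
        (if (h ≠ b ∧ h ≠ σ.mate b) ∧ σ.IsBad b then
          φ (σ.switchAt b h) / ((N - 2 : ℕ) : ℝ≥0∞) else 0) else 0) =
        ∑ b, ∑ h, (if σ.weight ≤ m * N then (if (h ≠ b ∧ h ≠ σ.mate b) ∧ σ.IsBad b then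
          φ (σ.switchAt b h) / ((N - 2 : ℕ) : ℝ≥0∞) else 0) else 0) := by
      intro σ
      split_ifs
      · rfl
      · simp
    simp only [h2]
    rw [Finset.sum_comm]
    have h3 : ∀ b : HalfEdge d, ∑ σ : Configuration d, ∑ h, (if σ.weight ≤ m * N then
        (if (h ≠ b ∧ h ≠ σ.mate b) ∧ σ.IsBad b then
          φ (σ.switchAt b h) / ((N - 2 : ℕ) : ℝ≥0∞) else 0) else 0) =
        ∑ τ : Configuration d, ∑ h, (if (τ.switchAt b h).weight ≤ m * N then
        (if (h ≠ b ∧ h ≠ τ.mate b) ∧ (τ.switchAt b h).IsBad b then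
          φ τ / ((N - 2 : ℕ) : ℝ≥0∞) else 0) else 0) := by
      intro b
      rw [Finset.sum_comm, Finset.sum_congr rfl fun h _ => h1 b h, Finset.sum_comm]
    simp only [h3]
    rw [Finset.sum_comm]
    refine Finset.sum_le_sum fun τ _ => ?_
    by_cases hτ : τ.weight ≤ (m + 8 * C) * N
    · rw [if_pos hτ]
      have h4 : ∑ b, ∑ h, (if (τ.switchAt b h).weight ≤ m * N then
          (if (h ≠ b ∧ h ≠ τ.mate b) ∧ (τ.switchAt b h).IsBad b then
            φ τ / ((N - 2 : ℕ) : ℝ≥0∞) else 0) else 0) ≤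
          ((∑ b : HalfEdge d, ∑ h : HalfEdge d,
            (if (h ≠ b ∧ h ≠ τ.mate b) ∧ (τ.switchAt b h).IsBad b then 1 else 0) : ℕ) : ℝ≥0∞) *
          (φ τ / ((N - 2 : ℕ) : ℝ≥0∞)) := by
        push_cast
        rw [Finset.sum_mul]
        refine Finset.sum_le_sum fun b _ => ?_
        rw [Finset.sum_mul]
        refine Finset.sum_le_sum fun h _ => ?_
        split_ifs <;> simp
      refine h4.trans ?_
      -- The count is at most 2CN + (m + 8C)N = (10C + m)N, and N ≤ 2(N - 2) because N ≥ 4.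
      have h5 : (∑ b : HalfEdge d, ∑ h : HalfEdge d,
          (if (h ≠ b ∧ h ≠ τ.mate b) ∧ (τ.switchAt b h).IsBad b then 1 else 0)) ≤
          2 * (10 * C + m) * (N - 2) := by
        refine τ.card_preimages_le.trans ?_
        obtain ⟨N', hN'⟩ := Nat.exists_eq_add_of_le hN
        have : N - 2 = N' + 2 := by omega
        rw [this]
        rw [hN'] at hτ hC
        nlinarith [Nat.zero_le (C * N'), Nat.zero_le (m * N')]
      have hpos : ((N - 2 : ℕ) : ℝ≥0∞) ≠ 0 := by
        rw [Nat.cast_ne_zero]; omega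
      calc _ ≤ ((2 * (10 * C + m) * (N - 2) : ℕ) : ℝ≥0∞) * (φ τ / ((N - 2 : ℕ) : ℝ≥0∞)) :=
            mul_le_mul_left (Nat.cast_le.2 h5) _
        _ = ((2 * (10 * C + m) : ℕ) : ℝ≥0∞) *
              (((N - 2 : ℕ) : ℝ≥0∞) * (φ τ / ((N - 2 : ℕ) : ℝ≥0∞))) := by
            rw [Nat.cast_mul _ (N - 2), mul_assoc]
        _ = _ := by rw [ENNReal.mul_div_cancel hpos (ENNReal.natCast_ne_top _)]
    · rw [if_neg hτ, mul_zero]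
      refine le_of_eq (Finset.sum_eq_zero fun b _ => Finset.sum_eq_zero fun h _ => ?_)
      rw [if_neg fun h0 => hτ (hw τ b h h0)]

/-- A bound for the density of the configuration after `k` steps, when the initial configuration
has bounded weight. -/
def densityBound (C : ℕ) : ℕ → ℕ → ℕ
  | _, 0 => 1
  | m, k + 1 => (1 + 2 * (10 * C + m)) * densityBound C (m + 8 * C) k

open Classical in
lemma sum_iterate_branch_le {C : ℕ} (hN : 4 ≤ Fintype.card (HalfEdge d))
    (hC : sqSum d ≤ C * Fintype.card (HalfEdge d)) (m k : ℕ) (φ : Configuration d → ℝ≥0∞) :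
    ∑ σ with σ.weight ≤ m * Fintype.card (HalfEdge d), branch^[k] φ σ ≤
      (densityBound C m k : ℝ≥0∞) * ∑ τ, φ τ := by
  induction k generalizing m with
  | zero =>
    simp only [densityBound, Nat.cast_one, one_mul, Function.iterate_zero, id]
    exact Finset.sum_le_sum_of_subset (Finset.subset_univ _)
  | succ k ih =>
    -- The outermost `branch` is the first step of the process; the weight bound loosens from there
    -- inwards.
    simp only [Function.iterate_succ_apply', densityBound]
    refine (sum_branch_le hN hC m _).trans ?_
    rw [Nat.cast_mul _ (densityBound _ _ _), mul_assoc]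
    exact mul_le_mul_right (ih _) _

/-! ### Termination -/

open Classical in
-- The process is on schedule at time `k` if at most `K - k` half-edges are bad. From such a state
-- only an exceptional switching can break the schedule. The subtraction is truncated: after time
-- `K` the schedule asks for a simple configuration, which then stays.
lemma expect_step_badCount (rule : Rule d) (hN : 2 < Fintype.card (HalfEdge d)) {r : ℕ}
    (hr : sqSum d ^ 3 ≤ r ^ 4) (K k : ℕ) (s : State d) :
    expect (step rule s) (fun t => if t.current.badCount ≤ K - (k + 1) then 0 else 1) ≤
      (if s.current.badCount ≤ K - k then 0 else 1) +
        ((K + 5 * r : ℕ) : ℝ≥0∞) / ((Fintype.card (HalfEdge d) - 2 : ℕ) : ℝ≥0∞) := by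
  by_cases hk : s.current.badCount ≤ K - k
  · rw [if_pos hk, zero_add]
    by_cases hs : ∃ b, s.current.IsBad b
    · rw [expect_step_of_bad rule hs hN fun τ => if τ.badCount ≤ K - (k + 1) then 0 else 1]
      refine (expect_mono _ fun b => ?_).trans_eq (expect_const _ _)
      refine ENNReal.div_le_div_right ?_ _
      rw [s.current.sum_other b.1 fun h =>
        if (s.current.switchAt b.1 h).badCount ≤ K - (k + 1) then (0 : ℝ≥0∞) else 1]
      have h1 : ∀ h, (if h ≠ b.1 ∧ h ≠ s.current.mate b.1 then
          (if (s.current.switchAt b.1 h).badCount ≤ K - (k + 1) then (0 : ℝ≥0∞) else 1) else 0) ≤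
          ((if s.current.Exceptional b.1 h then 1 else 0 : ℕ) : ℝ≥0∞) := by
        intro h
        by_cases he : s.current.Exceptional b.1 h
        · rw [if_pos he]
          split_ifs <;> simp
        · rw [if_neg he]
          split_ifs with h2 h3
          · simp
          · exfalso
            have := Configuration.badCount_switchAt_lt b.2 h2.1 h2.2 he
            omega
          · simp
      refine (Finset.sum_le_sum fun h _ => h1 h).trans ?_
      rw [← Nat.cast_sum, Nat.cast_le, ← Finset.card_filter]
      refine (s.current.card_exceptional_le b.1 hr).trans ?_
      omega
    · have h0 := (Configuration.badCount_eq_zero_iff s.current).2 hs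
      rw [expect_step_of_isSimple rule hs, if_pos (by omega)]
      exact zero_le
  · rw [if_neg hk]
    refine le_trans ?_ le_self_add
    refine (expect_mono _ (g := fun _ => 1) fun t => ?_).trans_eq (expect_const _ _)
    split_ifs <;> simp

open Classical in
lemma expect_run_badCount (rule : Rule d) (hN : 2 < Fintype.card (HalfEdge d)) {r : ℕ}
    (hr : sqSum d ^ 3 ≤ r ^ 4) {K : ℕ} {σ : Configuration d} (hσ : σ.badCount ≤ K) (k : ℕ) :
    expect (run rule σ k) (fun t => if t.current.badCount ≤ K - k then 0 else 1) ≤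
      k * (((K + 5 * r : ℕ) : ℝ≥0∞) / ((Fintype.card (HalfEdge d) - 2 : ℕ) : ℝ≥0∞)) := by
  induction k with
  | zero => simp [run, expect_pure, hσ]
  | succ k ih =>
    rw [run, expect_bind]
    refine (expect_mono _ fun s => expect_step_badCount rule hN hr K k s).trans ?_
    rw [expect_add, expect_const, Nat.cast_add k, add_mul, Nat.cast_one, one_mul]
    exact add_le_add_left ih _

open Classical in
lemma expect_run_not_isSimple (rule : Rule d) (hN : 2 < Fintype.card (HalfEdge d)) {r : ℕ}
    (hr : sqSum d ^ 3 ≤ r ^ 4) {K : ℕ} {σ : Configuration d} (hσ : σ.badCount ≤ K) :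
    expect (run rule σ K) (fun t => if t.current.IsSimple then 0 else 1) ≤
      K * (((K + 5 * r : ℕ) : ℝ≥0∞) / ((Fintype.card (HalfEdge d) - 2 : ℕ) : ℝ≥0∞)) := by
  have h := expect_run_badCount rule hN hr hσ K
  simpa only [Nat.sub_self, Nat.le_zero, Configuration.badCount_eq_zero_iff] using h
namespace Configuration

/-! ### Uniformly random configurations -/

/-- Relabelling the half-edges of a configuration. -/
def relabel (π : Equiv.Perm (HalfEdge d)) : Equiv.Perm (Configuration d) where
  toFun σ := ⟨fun x => π (σ.mate (π.symm x)), by simp [σ.mate_mate], by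
    intro x h
    exact σ.mate_ne (π.symm x) (π.injective (by rw [h, Equiv.apply_symm_apply]))⟩
  invFun σ := ⟨fun x => π.symm (σ.mate (π x)), by simp [σ.mate_mate], by
    intro x h
    exact σ.mate_ne (π x) (π.symm.injective (by rw [h, Equiv.symm_apply_apply]))⟩
  left_inv σ := by ext1; funext x; simp
  right_inv σ := by ext1; funext x; simp

lemma relabel_mate (π : Equiv.Perm (HalfEdge d)) (σ : Configuration d) (x : HalfEdge d) :
    (relabel π σ).mate x = π (σ.mate (π.symm x)) := rfl

lemma nonempty_of_even (h : Even (Fintype.card (HalfEdge d))) : Nonempty (Configuration d) := by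
  obtain ⟨m, hm⟩ := h
  obtain ⟨e⟩ : Nonempty (HalfEdge d ≃ Fin m × Bool) := by
    rw [← Fintype.card_eq]
    simp [hm, mul_two]
  exact ⟨fun x => e.symm ((e x).1, !(e x).2), by simp, fun x h => by
    have := congrArg (fun y => (e y).2) h
    simp at this⟩

open Classical in
-- By symmetry under transpositions of half-edges, all `u ≠ x` are equally likely mates of `x`.
lemma card_mate_eq_le (x u : HalfEdge d) :
    (Fintype.card (HalfEdge d) - 1) *
      (Finset.univ.filter fun σ : Configuration d => σ.mate x = u).card ≤
      Fintype.card (Configuration d) := by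
  by_cases hu : u = x
  · have : (Finset.univ.filter fun σ : Configuration d => σ.mate x = u) = ∅ := by
      ext σ
      simp only [Finset.mem_filter_univ, Finset.notMem_empty, iff_false, hu]
      exact σ.mate_ne x
    rw [this, Finset.card_empty, mul_zero]
    exact Nat.zero_le _
  have heq : ∀ v ∈ Finset.univ.erase x,
      (Finset.univ.filter fun σ : Configuration d => σ.mate x = v).card =
      (Finset.univ.filter fun σ : Configuration d => σ.mate x = u).card := by
    intro v hv
    have hv' := Finset.ne_of_mem_erase hv
    refine Finset.card_equiv (relabel (Equiv.swap u v)) fun σ => ?_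
    simp only [Finset.mem_filter_univ, relabel_mate, Equiv.symm_swap]
    rw [Equiv.swap_apply_of_ne_of_ne (Ne.symm hu) (Ne.symm hv'), Equiv.swap_apply_eq_iff,
      Equiv.swap_apply_left]
  have h1 : ∑ v ∈ Finset.univ.erase x,
      (Finset.univ.filter fun σ : Configuration d => σ.mate x = v).card ≤
      Fintype.card (Configuration d) := by
    rw [← Finset.card_univ, Finset.card_eq_sum_card_fiberwise (f := fun σ => σ.mate x)
      (t := Finset.univ) (by simp [Set.MapsTo])]
    exact Finset.sum_le_sum_of_subset (Finset.erase_subset _ _)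
  rwa [Finset.sum_congr rfl heq, Finset.sum_const, Finset.card_erase_of_mem (Finset.mem_univ x),
    Finset.card_univ, smul_eq_mul] at h1

open Classical in
-- The same symmetry under transpositions that fix `x`, `y` and `u`; if `v` is one of these three,
-- no configuration qualifies.
lemma card_mate_eq_and_mate_eq_le {x y u : HalfEdge d} (hyx : y ≠ x) (hyu : y ≠ u)
    (v : HalfEdge d) :
    (Fintype.card (HalfEdge d) - 3) *
      (Finset.univ.filter fun σ : Configuration d => σ.mate x = u ∧ σ.mate y = v).card ≤
      (Finset.univ.filter fun σ : Configuration d => σ.mate x = u).card := by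
  by_cases hv : v = x ∨ v = y ∨ v = u
  · have : (Finset.univ.filter fun σ : Configuration d => σ.mate x = u ∧ σ.mate y = v) = ∅ := by
      ext σ
      simp only [Finset.mem_filter_univ, Finset.notMem_empty, iff_false]
      rintro ⟨h1, h2⟩
      rcases hv with rfl | rfl | rfl
      · apply hyu
        rw [← h1, ← h2, σ.mate_mate]
      · exact σ.mate_ne _ h2
      · apply hyx
        rw [← σ.mate_mate y, h2, ← h1, σ.mate_mate]
    rw [this, Finset.card_empty, mul_zero]
    exact Nat.zero_le _
  push Not at hv
  have heq : ∀ w ∈ Finset.univ \ {x, y, u},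
      (Finset.univ.filter fun σ : Configuration d => σ.mate x = u ∧ σ.mate y = w).card =
      (Finset.univ.filter fun σ : Configuration d => σ.mate x = u ∧ σ.mate y = v).card := by
    intro w hw
    simp only [Finset.mem_sdiff, Finset.mem_univ, Finset.mem_insert, Finset.mem_singleton,
      true_and, not_or] at hw
    refine Finset.card_equiv (relabel (Equiv.swap v w)) fun σ => ?_
    simp only [Finset.mem_filter_univ, relabel_mate, Equiv.symm_swap]
    rw [Equiv.swap_apply_of_ne_of_ne (Ne.symm hv.1) (Ne.symm hw.1),
      Equiv.swap_apply_of_ne_of_ne (Ne.symm hv.2.1) (Ne.symm hw.2.1), Equiv.swap_apply_eq_iff,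
      Equiv.swap_apply_eq_iff, Equiv.swap_apply_left,
      Equiv.swap_apply_of_ne_of_ne (Ne.symm hv.2.2) (Ne.symm hw.2.2)]
  have h1 : ∑ w ∈ Finset.univ \ {x, y, u},
      (Finset.univ.filter fun σ : Configuration d => σ.mate x = u ∧ σ.mate y = w).card ≤
      (Finset.univ.filter fun σ : Configuration d => σ.mate x = u).card := by
    rw [Finset.card_eq_sum_card_fiberwise (f := fun σ : Configuration d => σ.mate y)
      (s := Finset.univ.filter fun σ : Configuration d => σ.mate x = u)
      (t := Finset.univ) (by simp [Set.MapsTo])]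
    simp only [Finset.filter_filter]
    exact Finset.sum_le_sum_of_subset (Finset.subset_univ _)
  rw [Finset.sum_congr rfl heq, Finset.sum_const, smul_eq_mul] at h1
  refine le_trans (Nat.mul_le_mul_right _ ?_) h1
  have h2 := Finset.le_card_sdiff {x, y, u} (Finset.univ : Finset (HalfEdge d))
  have h3 : ({x, y, u} : Finset (HalfEdge d)).card ≤ 3 := Finset.card_le_three
  rw [Finset.card_univ] at h2
  omega

lemma sum_weight_le :
    (Fintype.card (HalfEdge d) - 1) * ∑ σ : Configuration d, σ.weight ≤
      Fintype.card (Configuration d) *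
        (sqSum d ^ 2 + Fintype.card (HalfEdge d) * sqSum d) := by
  classical
  have h1 : ∀ σ : Configuration d, σ.weight =
      ∑ x, ∑ u, pairWeight x u * if σ.mate x = u then 1 else 0 := by
    intro σ
    simp [weight]
  simp only [h1]
  rw [Finset.sum_comm, Finset.mul_sum, ← sum_pairWeight, Finset.mul_sum]
  refine Finset.sum_le_sum fun x _ => ?_
  rw [Finset.sum_comm, Finset.mul_sum, Finset.mul_sum]
  refine Finset.sum_le_sum fun u _ => ?_
  rw [← Finset.mul_sum, ← Finset.card_filter]
  calc _ = (Fintype.card (HalfEdge d) - 1) *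
        (Finset.univ.filter fun σ : Configuration d => σ.mate x = u).card * pairWeight x u := by
        ring
    _ ≤ _ := Nat.mul_le_mul_right _ (card_mate_eq_le x u)

open Classical in
lemma badCount_le (σ : Configuration d) : σ.badCount ≤
    ∑ x, (if x.1 = (σ.mate x).1 then 1 else 0) +
      ∑ x, ∑ y, if y ≠ x ∧ y ≠ σ.mate x ∧ y.1 = x.1 ∧ (σ.mate y).1 = (σ.mate x).1
        then 1 else 0 := by
  rw [badCount, Finset.card_filter, ← Finset.sum_add_distrib]
  refine Finset.sum_le_sum fun x _ => ?_
  by_cases hx : σ.IsBad x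
  · rw [if_pos hx]
    rcases (σ.isBad_iff x).1 hx with h | ⟨y, hy⟩
    · rw [if_pos h]
      omega
    · refine le_trans ?_ le_add_self
      refine le_trans ?_ (Finset.single_le_sum (f := fun y : HalfEdge d =>
        if y ≠ x ∧ y ≠ σ.mate x ∧ y.1 = x.1 ∧ (σ.mate y).1 = (σ.mate x).1 then 1 else 0)
        (fun _ _ => Nat.zero_le _) (Finset.mem_univ y))
      simp only [if_pos hy, le_refl]
  · rw [if_neg hx]
    exact Nat.zero_le _

open Classical in
lemma sum_loops_le :
    (Fintype.card (HalfEdge d) - 1) * ∑ σ : Configuration d, ∑ x : HalfEdge d,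
      (if x.1 = (σ.mate x).1 then 1 else 0) ≤ Fintype.card (Configuration d) * sqSum d := by
  have h1 : ∀ (σ : Configuration d) (x : HalfEdge d), (if x.1 = (σ.mate x).1 then 1 else 0) =
      ∑ u : HalfEdge d, (if x.1 = u.1 then 1 else 0) * if σ.mate x = u then 1 else 0 := by
    intro σ x
    simp
  simp only [h1]
  rw [Finset.sum_comm, Finset.mul_sum, ← sum_degree, Finset.mul_sum]
  refine Finset.sum_le_sum fun x _ => ?_
  rw [Finset.sum_comm, Finset.mul_sum, ← sum_fst_eq' (d := d) x.1, Finset.mul_sum]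
  refine Finset.sum_le_sum fun u _ => ?_
  rw [← Finset.mul_sum, ← Finset.card_filter]
  calc _ = (Fintype.card (HalfEdge d) - 1) *
        (Finset.univ.filter fun σ : Configuration d => σ.mate x = u).card *
          (if x.1 = u.1 then 1 else 0) := by ring
    _ ≤ _ := Nat.mul_le_mul_right _ (card_mate_eq_le x u)

open Classical in
lemma sum_parallel_le :
    (Fintype.card (HalfEdge d) - 1) * (Fintype.card (HalfEdge d) - 3) *
      ∑ σ : Configuration d, ∑ x : HalfEdge d, ∑ y : HalfEdge d,
        (if y ≠ x ∧ y ≠ σ.mate x ∧ y.1 = x.1 ∧ (σ.mate y).1 = (σ.mate x).1 then 1 else 0) ≤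
      Fintype.card (Configuration d) * sqSum d ^ 2 := by
  set N := Fintype.card (HalfEdge d)
  have h1 : ∀ (σ : Configuration d) (x y : HalfEdge d),
      (if y ≠ x ∧ y ≠ σ.mate x ∧ y.1 = x.1 ∧ (σ.mate y).1 = (σ.mate x).1 then 1 else 0) =
      ∑ u : HalfEdge d, ∑ v : HalfEdge d,
        (if y ≠ x ∧ y ≠ u then (if y.1 = x.1 then 1 else 0) * (if v.1 = u.1 then 1 else 0) else 0) *
          if σ.mate x = u ∧ σ.mate y = v then 1 else 0 := by
    intro σ x y
    rw [Finset.sum_eq_single (σ.mate x), Finset.sum_eq_single (σ.mate y)]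
    · simp only [and_self, if_true, mul_one]
      split_ifs <;> simp_all
    · intro v _ hv
      rw [if_neg (show ¬ (σ.mate x = σ.mate x ∧ σ.mate y = v) from fun h => hv h.2.symm), mul_zero]
    · simp
    · intro u _ hu
      refine Finset.sum_eq_zero fun v _ => ?_
      rw [if_neg (show ¬ (σ.mate x = u ∧ σ.mate y = v) from fun h => hu h.1.symm), mul_zero]
    · simp
  have h2 : sqSum d ^ 2 = ∑ x : HalfEdge d, ∑ y : HalfEdge d, ∑ u : HalfEdge d, ∑ v : HalfEdge d,
      (if y.1 = x.1 then 1 else 0) * (if v.1 = u.1 then 1 else 0) := by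
    simp only [← Finset.mul_sum, sum_fst_eq, ← Finset.sum_mul, sum_degree]
    ring
  simp only [h1]
  rw [Finset.sum_comm, Finset.mul_sum, h2, Finset.mul_sum]
  refine Finset.sum_le_sum fun x _ => ?_
  rw [Finset.sum_comm, Finset.mul_sum, Finset.mul_sum]
  refine Finset.sum_le_sum fun y _ => ?_
  rw [Finset.sum_comm, Finset.mul_sum, Finset.mul_sum]
  refine Finset.sum_le_sum fun u _ => ?_
  rw [Finset.sum_comm, Finset.mul_sum, Finset.mul_sum]
  refine Finset.sum_le_sum fun v _ => ?_
  rw [← Finset.mul_sum, ← Finset.card_filter]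
  by_cases hy : y ≠ x ∧ y ≠ u
  · rw [if_pos hy]
    have h3 := card_mate_eq_and_mate_eq_le hy.1 hy.2 v
    have h4 := (Nat.mul_le_mul_left (N - 1) h3).trans (card_mate_eq_le x u)
    calc _ = (N - 1) * ((N - 3) * (Finset.univ.filter fun σ : Configuration d =>
          σ.mate x = u ∧ σ.mate y = v).card) *
          ((if y.1 = x.1 then 1 else 0) * (if v.1 = u.1 then 1 else 0)) := by ring
      _ ≤ _ := Nat.mul_le_mul_right _ h4
  · rw [if_neg hy, zero_mul, mul_zero]
    exact Nat.zero_le _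

/-! ### Markov bounds for the weight and for the number of bad half-edges. -/

open Classical in
lemma card_weight_gt_le {C : ℕ} (hN : 4 ≤ Fintype.card (HalfEdge d))
    (hC : sqSum d ≤ C * Fintype.card (HalfEdge d)) (m : ℕ) :
    (Finset.univ.filter fun σ : Configuration d =>
        ¬ σ.weight ≤ m * Fintype.card (HalfEdge d)).card * m ≤
      Fintype.card (Configuration d) * (2 * (C ^ 2 + C)) := by
  set N := Fintype.card (HalfEdge d)
  have h1 : (Finset.univ.filter fun σ : Configuration d => ¬ σ.weight ≤ m * N).card * (m * N) ≤
      ∑ σ : Configuration d, σ.weight := by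
    rw [← smul_eq_mul]
    refine (Finset.card_nsmul_le_sum _ (fun σ => σ.weight) _ fun σ hσ => ?_).trans
      (Finset.sum_le_sum_of_subset (Finset.subset_univ _))
    simp only [Finset.mem_filter, Finset.mem_univ, true_and] at hσ
    omega
  have h2 := sum_weight_le (d := d)
  have h3 : sqSum d ^ 2 + N * sqSum d ≤ (C ^ 2 + C) * N ^ 2 := by
    calc sqSum d ^ 2 + N * sqSum d ≤ (C * N) ^ 2 + N * (C * N) :=
          Nat.add_le_add (Nat.pow_le_pow_left hC 2) (Nat.mul_le_mul_left _ hC)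
      _ = _ := by ring
  have h4 : N ≤ 2 * (N - 1) := by omega
  refine Nat.le_of_mul_le_mul_right (c := N ^ 2) ?_ (by positivity)
  calc _ = N * ((Finset.univ.filter fun σ : Configuration d => ¬ σ.weight ≤ m * N).card *
        (m * N)) := by ring
    _ ≤ (2 * (N - 1)) * ∑ σ : Configuration d, σ.weight := Nat.mul_le_mul h4 h1
    _ = 2 * ((N - 1) * ∑ σ : Configuration d, σ.weight) := by ring
    _ ≤ 2 * (Fintype.card (Configuration d) * ((C ^ 2 + C) * N ^ 2)) :=
        Nat.mul_le_mul_left _ (h2.trans (Nat.mul_le_mul_left _ h3))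
    _ = _ := by ring

open Classical in
lemma card_badCount_gt_le {C : ℕ} (hN : 4 ≤ Fintype.card (HalfEdge d))
    (hC : sqSum d ≤ C * Fintype.card (HalfEdge d)) (K : ℕ) :
    (Finset.univ.filter fun σ : Configuration d => ¬ σ.badCount ≤ K).card * K ≤
      Fintype.card (Configuration d) * (2 * C + 8 * C ^ 2) := by
  set N := Fintype.card (HalfEdge d)
  have h1 : (Finset.univ.filter fun σ : Configuration d => ¬ σ.badCount ≤ K).card * K ≤
      ∑ σ : Configuration d, σ.badCount := by
    rw [← smul_eq_mul]
    refine (Finset.card_nsmul_le_sum _ (fun σ => σ.badCount) _ fun σ hσ => ?_).trans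
      (Finset.sum_le_sum_of_subset (Finset.subset_univ _))
    simp only [Finset.mem_filter, Finset.mem_univ, true_and] at hσ
    omega
  refine h1.trans ((Finset.sum_le_sum fun σ _ => σ.badCount_le).trans ?_)
  rw [Finset.sum_add_distrib, mul_add]
  have h4 : N ≤ 2 * (N - 1) := by omega
  have h5 : N ≤ 4 * (N - 3) := by omega
  refine Nat.add_le_add ?_ ?_
  · refine _root_.le_of_mul_le_mul_left (a := N) ?_ (by positivity)
    refine (Nat.mul_le_mul_right _ h4).trans ?_
    rw [mul_assoc]
    refine (Nat.mul_le_mul_left 2 (sum_loops_le.trans (Nat.mul_le_mul_left _ hC))).trans_eq ?_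
    ring
  · refine _root_.le_of_mul_le_mul_left (a := N * N) ?_ (by positivity)
    refine (Nat.mul_le_mul_right _ (Nat.mul_le_mul h4 h5)).trans ?_
    rw [show 2 * (N - 1) * (4 * (N - 3)) = 8 * ((N - 1) * (N - 3)) by ring, mul_assoc]
    refine (Nat.mul_le_mul_left 8 (sum_parallel_le.trans
      (Nat.mul_le_mul_left _ (Nat.pow_le_pow_left hC 2)))).trans_eq ?_
    ring

end Configuration

/-! ### Simple configurations and simple graphs -/

/-- The σ-algebra is the one of the adjacency events. With measurable singletons, every set of
graphs on `Fin n` is measurable, by finiteness. -/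
instance : MeasurableSingletonClass (SimpleGraph (Fin n)) where
  measurableSet_singleton G := by
    have h : ({G} : Set (SimpleGraph (Fin n))) =
        ⋂ u, ⋂ v, {H : SimpleGraph (Fin n) | H.Adj u v ↔ G.Adj u v} := by
      ext H
      simp only [Set.mem_singleton_iff, Set.mem_iInter, Set.mem_ofPred_eq]
      exact ⟨fun h u v => by rw [h], fun h => by ext u v; exact h u v⟩
    rw [h]
    refine MeasurableSet.iInter fun u => MeasurableSet.iInter fun v => ?_
    have hm : Measurable fun H : SimpleGraph (Fin n) => H.Adj u v :=
      SimpleGraph.measurable_iff_adj.1 measurable_id u v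
    exact (hm.iff measurable_const).setOf

namespace Configuration

lemma IsSimple.fst_ne {σ : Configuration d} (hσ : σ.IsSimple) (x : HalfEdge d) :
    x.1 ≠ (σ.mate x).1 :=
  fun h => hσ ⟨x, (σ.isBad_iff x).2 (Or.inl h)⟩

lemma IsSimple.eq_of_fst_eq {σ : Configuration d} (hσ : σ.IsSimple) {x y : HalfEdge d}
    (h1 : x.1 = y.1) (h2 : (σ.mate x).1 = (σ.mate y).1) : x = y := by
  by_contra hne
  by_cases hm : x = σ.mate y
  · exact hσ.fst_ne y (by rw [← hm, h1])
  · exact hσ ⟨y, (σ.isBad_iff y).2 (Or.inr ⟨x, hne, hm, h1, h2⟩)⟩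

/-- In a simple configuration, the half-edges at a vertex correspond to its neighbours. -/
noncomputable def IsSimple.neighborEquiv {σ : Configuration d} (hσ : σ.IsSimple) (i : Fin n) :
    Fin (d i) ≃ σ.toGraph.neighborSet i :=
  Equiv.ofBijective
    (fun k => ⟨(σ.mate ⟨i, k⟩).1, hσ.fst_ne ⟨i, k⟩, ⟨i, k⟩, rfl, rfl⟩)
    ⟨fun k l h => by
      have h1 := hσ.eq_of_fst_eq (x := ⟨i, k⟩) (y := ⟨i, l⟩) rfl (congrArg Subtype.val h)
      simpa using h1,
    fun ⟨j, hj⟩ => by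
      obtain ⟨-, ⟨i', k⟩, h1, h2⟩ := hj
      dsimp only at h1
      subst h1
      exact ⟨k, Subtype.ext h2⟩⟩

lemma IsSimple.toGraph_mem {σ : Configuration d} (hσ : σ.IsSimple) :
    σ.toGraph ∈ graphsWithDegrees d := by
  classical
  intro i
  rw [← SimpleGraph.card_neighborSet_eq_degree, ← Fintype.card_fin (d i)]
  exact (Fintype.card_congr (hσ.neighborEquiv i)).symm

/-- The half-edge at the neighbour that is matched with `x`, for given correspondences of
half-edges and neighbours. -/
def mateOfEquiv {G : SimpleGraph (Fin n)} (e : ∀ i, Fin (d i) ≃ G.neighborSet i)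
    (x : HalfEdge d) : HalfEdge d :=
  ⟨(e x.1 x.2).1, (e (e x.1 x.2).1).symm ⟨x.1, G.adj_symm (e x.1 x.2).2⟩⟩

section

variable {G : SimpleGraph (Fin n)} (e : ∀ i, Fin (d i) ≃ G.neighborSet i)

lemma eq_of_equiv_eq {x y : HalfEdge d} (h1 : x.1 = y.1)
    (h2 : (e x.1 x.2).1 = (e y.1 y.2).1) : x = y := by
  obtain ⟨i, k⟩ := x
  obtain ⟨j, l⟩ := y
  dsimp only at h1 h2
  subst h1
  rw [(e i).injective (Subtype.ext h2)]

lemma equiv_mateOfEquiv (x : HalfEdge d) :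
    (e (mateOfEquiv e x).1 (mateOfEquiv e x).2).1 = x.1 :=
  congrArg Subtype.val ((e (e x.1 x.2).1).apply_symm_apply ⟨x.1, G.adj_symm (e x.1 x.2).2⟩)

/-- The configuration given by correspondences of half-edges and neighbours in a graph. -/
def ofEquiv : Configuration d where
  mate := mateOfEquiv e
  mate_mate x := by
    refine eq_of_equiv_eq e ?_ ?_
    · exact equiv_mateOfEquiv e x
    · rw [equiv_mateOfEquiv]; rfl
  mate_ne x h := G.ne_of_adj (e x.1 x.2).2 (congrArg Sigma.fst h).symm

lemma ofEquiv_mate_fst (x : HalfEdge d) : ((ofEquiv e).mate x).1 = (e x.1 x.2).1 := rfl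

lemma isSimple_ofEquiv : (ofEquiv e).IsSimple := by
  rintro ⟨x, hx⟩
  rw [isBad_iff] at hx
  rcases hx with h | ⟨y, h1, -, h3, h4⟩
  · exact G.ne_of_adj (e x.1 x.2).2 h
  · exact h1 (eq_of_equiv_eq e h3 h4)

lemma toGraph_ofEquiv : (ofEquiv e).toGraph = G := by
  ext i j
  constructor
  · rintro ⟨-, x, rfl, rfl⟩
    exact (e x.1 x.2).2
  · intro h
    refine ⟨G.ne_of_adj h, ⟨i, (e i).symm ⟨j, h⟩⟩, rfl, ?_⟩
    rw [ofEquiv_mate_fst]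
    simp

end

open Classical in
-- A simple configuration over `G` amounts to a bijection, at every vertex, from its half-edges to
-- its neighbours. The count does not depend on `G`, so a uniform simple configuration gives a
-- uniform graph.
lemma card_toGraph_eq {G : SimpleGraph (Fin n)} (hG : G ∈ graphsWithDegrees d) :
    (Finset.univ.filter fun σ : Configuration d => σ.IsSimple ∧ σ.toGraph = G).card =
      ∏ i, (d i).factorial := by
  have hbij : Function.Bijective
      (fun e : (∀ i, Fin (d i) ≃ G.neighborSet i) =>
        (⟨ofEquiv e, isSimple_ofEquiv e, toGraph_ofEquiv e⟩ :
          {σ : Configuration d // σ.IsSimple ∧ σ.toGraph = G})) := by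
    constructor
    · intro e e' h
      have h0 : ofEquiv e = ofEquiv e' := congrArg Subtype.val h
      funext i
      ext k
      have h1 := ofEquiv_mate_fst e ⟨i, k⟩
      rw [h0, ofEquiv_mate_fst] at h1
      exact congrArg Fin.val h1.symm
    · rintro ⟨σ, hσ, rfl⟩
      refine ⟨fun i => hσ.neighborEquiv i, Subtype.ext ?_⟩
      ext1
      funext x
      refine eq_of_equiv_eq (fun i => hσ.neighborEquiv i) rfl ?_
      change (σ.mate ((ofEquiv fun i => hσ.neighborEquiv i).mate x)).1 =
        (σ.mate (σ.mate x)).1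
      rw [σ.mate_mate]
      exact equiv_mateOfEquiv (fun i => hσ.neighborEquiv i) x
  rw [← Fintype.card_subtype, ← Fintype.card_of_bijective hbij, Fintype.card_pi]
  refine Finset.prod_congr rfl fun i _ => ?_
  have hc : Fintype.card (Fin (d i)) = Fintype.card (G.neighborSet i) := by
    rw [Fintype.card_fin, SimpleGraph.card_neighborSet_eq_degree]
    exact (hG i).symm
  rw [Fintype.card_equiv (Fintype.equivOfCardEq hc), Fintype.card_fin]

open Classical in
/-- The number of simple configurations that project to a graph in `E`. -/
noncomputable def simpleCount (d : Fin n → ℕ) (E : Set (SimpleGraph (Fin n))) : ℕ :=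
  (Finset.univ.filter fun σ : Configuration d => σ.IsSimple ∧ σ.toGraph ∈ E).card

lemma simpleCount_eq (E : Set (SimpleGraph (Fin n))) :
    simpleCount d E = (graphsWithDegrees d ∩ E).ncard * ∏ i, (d i).factorial := by
  classical
  rw [Set.ncard_eq_toFinset_card', simpleCount, ← smul_eq_mul, ← Finset.sum_const,
    Finset.card_eq_sum_card_fiberwise (f := fun σ : Configuration d => σ.toGraph)
      (t := (graphsWithDegrees d ∩ E).toFinset)]
  · refine Finset.sum_congr rfl fun G hG => ?_
    rw [Set.mem_toFinset] at hG
    rw [← card_toGraph_eq hG.1, Finset.filter_filter]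
    congr 1
    ext σ
    simp only [Finset.mem_filter_univ]
    constructor
    · rintro ⟨⟨h1, -⟩, h3⟩
      exact ⟨h1, h3⟩
    · rintro ⟨h1, rfl⟩
      exact ⟨⟨h1, hG.2⟩, rfl⟩
  · intro σ hσ
    simp only [Finset.coe_filter, Finset.mem_univ, true_and, Set.mem_ofPred_eq] at hσ
    simpa using ⟨hσ.1.toGraph_mem, hσ.2⟩

end Configuration

open SwitchedGraph.Configuration

lemma uniformLaw_apply (E : Set (SimpleGraph (Fin n))) :
    uniformLaw d E = ((graphsWithDegrees d).ncard : ℝ≥0∞)⁻¹ *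
      ((graphsWithDegrees d ∩ E).ncard : ℝ≥0∞) := by
  rw [uniformLaw, ProbabilityTheory.uniformOn,
    ProbabilityTheory.cond_apply (Set.toFinite _).measurableSet]
  have h : ∀ s : Set (SimpleGraph (Fin n)), Measure.count s = (s.ncard : ℝ≥0∞) := by
    intro s
    rw [Measure.count_apply_finite s (Set.toFinite s), Set.ncard_eq_toFinset_card s]
  rw [h, h]

lemma simpleCount_eq_mul_uniformLaw (E : Set (SimpleGraph (Fin n))) :
    (simpleCount d E : ℝ≥0∞) = simpleCount d Set.univ * uniformLaw d E := by
  rw [uniformLaw_apply, simpleCount_eq, simpleCount_eq, Set.inter_univ]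
  rcases Nat.eq_zero_or_pos (graphsWithDegrees d).ncard with h | h
  · have h1 : (graphsWithDegrees d ∩ E).ncard = 0 :=
      Nat.le_zero.1 (h ▸ Set.ncard_le_ncard Set.inter_subset_left (Set.toFinite _))
    rw [h, h1]
    simp
  · have h0 : ((graphsWithDegrees d).ncard : ℝ≥0∞) ≠ 0 := Nat.cast_ne_zero.2 h.ne'
    push_cast
    rw [mul_right_comm, ← mul_assoc, ENNReal.mul_inv_cancel h0 (ENNReal.natCast_ne_top _), one_mul]

lemma isProbabilityMeasure_uniformLaw (h : simpleCount d Set.univ ≠ 0) :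
    IsProbabilityMeasure (uniformLaw d) := by
  refine ProbabilityTheory.isProbabilityMeasure_uniformOn (Set.toFinite _) ?_
  by_contra h0
  rw [Set.not_nonempty_iff_eq_empty] at h0
  apply h
  rw [simpleCount_eq, h0]
  simp

/-! ### The law of the result of the process -/

open Classical in
/-- The probability that the process has terminated with a graph in `E` after `k` steps. -/
noncomputable def eventProb (rule : Rule d) (k : ℕ) (E : Set (SimpleGraph (Fin n))) : ℝ≥0∞ :=
  (∑ σ : Configuration d, expect (run rule σ k) fun s =>
    if s.current.IsSimple ∧ s.current.toGraph ∈ E then 1 else 0) /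
    Fintype.card (Configuration d)

lemma State.result_eq_some_iff (s : State d) (G : SimpleGraph (Fin n)) :
    s.result = some G ↔ s.current.IsSimple ∧ s.current.toGraph = G := by
  unfold State.result
  split_ifs with h <;> simp [h]

lemma resultProb_eq (rule : Rule d) (k : ℕ) (G : SimpleGraph (Fin n)) :
    resultProb rule k G = eventProb rule k {G} := by
  classical
  unfold resultProb eventProb
  simp only [map_apply_eq_expect, State.result_eq_some_iff, Set.mem_singleton_iff]

open Classical in
lemma sum_resultProb (rule : Rule d) (k : ℕ) (E : Set (SimpleGraph (Fin n))) :
    ∑ G with G ∈ E, resultProb rule k G = eventProb rule k E := by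
  simp only [resultProb_eq, eventProb, ENNReal.div_eq_inv_mul, ← Finset.mul_sum]
  rw [Finset.sum_comm]
  congr 1
  refine Finset.sum_congr rfl fun σ _ => ?_
  rw [← expect_finsetSum]
  congr 1
  funext s
  simp only [Set.mem_singleton_iff]
  by_cases h : s.current.IsSimple ∧ s.current.toGraph ∈ E
  · rw [if_pos h, Finset.sum_eq_single s.current.toGraph]
    · simp [h.1]
    · intro G _ hG
      rw [if_neg fun h0 => hG h0.2.symm]
    · intro h0
      simp [h.2] at h0
  · rw [if_neg h]
    refine Finset.sum_eq_zero fun G hG => ?_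
    rw [if_neg]
    rintro ⟨h1, rfl⟩
    exact h ⟨h1, by simpa using hG⟩

/-- Simple configurations are absorbing. -/
lemma monotone_eventProb (rule : Rule d) (E : Set (SimpleGraph (Fin n))) :
    Monotone fun k => eventProb rule k E := by
  classical
  refine monotone_nat_of_le_succ fun k => ENNReal.div_le_div_right ?_ _
  refine Finset.sum_le_sum fun σ _ => ?_
  rw [run, expect_bind]
  refine expect_mono _ fun s => ?_
  split_ifs with h
  · rw [expect_step_of_isSimple rule h.1, if_pos h]
  · exact zero_le

lemma terminalMeasure_apply (rule : Rule d) (E : Set (SimpleGraph (Fin n))) :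
    terminalMeasure rule E = ⨆ k, eventProb rule k E := by
  classical
  have hmono : ∀ G, Monotone fun k => resultProb rule k G := fun G => by
    simpa only [resultProb_eq] using monotone_eventProb rule {G}
  simp only [← sum_resultProb]
  rw [← ENNReal.finsetSum_iSup_of_monotone hmono, terminalMeasure, Finset.sum_filter,
    Measure.finsetSum_apply]
  refine Finset.sum_congr ?_ fun G _ => ?_
  · congr!
  rw [Measure.smul_apply, Measure.dirac_apply' _ (Set.toFinite E).measurableSet, smul_eq_mul]
  split_ifs with h <;> simp [h]

lemma eventProb_zero (rule : Rule d) (E : Set (SimpleGraph (Fin n))) :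
    eventProb rule 0 E = (simpleCount d E : ℝ≥0∞) / Fintype.card (Configuration d) := by
  classical
  simp only [eventProb, run, expect_pure, simpleCount, Finset.card_filter]
  push_cast
  rfl

lemma eventProb_le_one (rule : Rule d) (k : ℕ) (E : Set (SimpleGraph (Fin n))) :
    eventProb rule k E ≤ 1 := by
  classical
  refine ENNReal.div_le_of_le_mul ?_
  rw [one_mul]
  refine (Finset.sum_le_sum (g := fun _ => (1 : ℝ≥0∞)) fun σ _ => ?_).trans_eq (by simp)
  refine (expect_mono _ (g := fun _ => 1) fun s => ?_).trans_eq (expect_const _ _)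
  split_ifs <;> simp

/-! ### Comparison of the two laws -/

open Classical in
-- The event on the right counts an unfinished run as a success, so its probability can only
-- decrease with time. This reduces all later times to the fixed time `K`.
lemma expect_run_le_of_isSimple (rule : Rule d) (σ : Configuration d)
    (E : Set (SimpleGraph (Fin n))) {K k : ℕ} (hk : K ≤ k) :
    expect (run rule σ k) (fun s => if s.current.IsSimple ∧ s.current.toGraph ∈ E then 1 else 0) ≤
      expect (run rule σ K)
        (fun s => if s.current.IsSimple → s.current.toGraph ∈ E then 1 else 0) := by
  refine (expect_mono _
    (g := fun s => if s.current.IsSimple → s.current.toGraph ∈ E then 1 else 0)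
    fun s => ?_).trans ?_
  · by_cases h : s.current.IsSimple ∧ s.current.toGraph ∈ E
    · rw [if_pos h, if_pos fun _ => h.2]
    · rw [if_neg h]
      exact zero_le
  · induction k, hk using Nat.le_induction with
    | base => exact le_rfl
    | succ k _ ih =>
      refine le_trans ?_ ih
      rw [run, expect_bind]
      refine expect_mono _ fun s => ?_
      by_cases hs : s.current.IsSimple
      · rw [expect_step_of_isSimple rule hs]
      · rw [if_pos fun h => absurd h hs]
        refine (expect_mono _ (g := fun _ => 1) fun t => ?_).trans_eq (expect_const _ _)
        split_ifs <;> simp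

open Classical in
-- Initial configurations that are heavy or have too many bad half-edges are given up, with
-- probability 1 each. For the others, the run is either still unfinished at time `K`, or simple
-- with its graph in `E`, where the density bound applies.
lemma sum_expect_run_le (rule : Rule d) {C : ℕ} (hN : 4 ≤ Fintype.card (HalfEdge d))
    (hC : sqSum d ≤ C * Fintype.card (HalfEdge d)) {r : ℕ} (hr : sqSum d ^ 3 ≤ r ^ 4)
    (m K : ℕ) (E : Set (SimpleGraph (Fin n))) :
    ∑ σ : Configuration d, expect (run rule σ K)
        (fun s => if s.current.IsSimple → s.current.toGraph ∈ E then 1 else 0) ≤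
      (densityBound C m K : ℝ≥0∞) * simpleCount d E +
      (Fintype.card (Configuration d) * (K *
        (((K + 5 * r : ℕ) : ℝ≥0∞) / ((Fintype.card (HalfEdge d) - 2 : ℕ) : ℝ≥0∞))) +
      ((Finset.univ.filter fun σ : Configuration d =>
          ¬ σ.weight ≤ m * Fintype.card (HalfEdge d)).card +
        (Finset.univ.filter fun σ : Configuration d => ¬ σ.badCount ≤ K).card)) := by
  set N := Fintype.card (HalfEdge d)
  set η : ℝ≥0∞ := K * (((K + 5 * r : ℕ) : ℝ≥0∞) / ((N - 2 : ℕ) : ℝ≥0∞))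
  set φ : Configuration d → ℝ≥0∞ := fun τ => if τ.IsSimple ∧ τ.toGraph ∈ E then 1 else 0 with hφ
  have hle : ∀ σ : Configuration d, expect (run rule σ K)
      (fun s => if s.current.IsSimple → s.current.toGraph ∈ E then 1 else 0) ≤
      (if σ.weight ≤ m * N then branch^[K] φ σ else 0) + (η +
        ((if ¬ σ.weight ≤ m * N then 1 else 0) + (if ¬ σ.badCount ≤ K then 1 else 0))) := by
    intro σ
    have hone : expect (run rule σ K)
        (fun s => if s.current.IsSimple → s.current.toGraph ∈ E then 1 else 0) ≤ 1 := by
      refine (expect_mono _ (g := fun _ => 1) fun t => ?_).trans_eq (expect_const _ _)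
      split_ifs <;> simp
    by_cases hw : σ.weight ≤ m * N
    · by_cases hb : σ.badCount ≤ K
      · rw [if_pos hw]
        refine le_trans ?_ (add_le_add_right le_self_add _)
        refine le_trans ?_ (add_le_add (expect_run_le_branch rule (by omega) σ K φ)
          (expect_run_not_isSimple rule (by omega) hr hb))
        rw [← expect_add]
        refine expect_mono _ fun s => ?_
        by_cases hs : s.current.IsSimple <;> by_cases hE : s.current.toGraph ∈ E <;>
          simp [hφ, hs, hE]
      · refine hone.trans (le_add_of_le_right (le_add_of_le_right (le_add_of_le_right ?_)))
        rw [if_pos hb]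
    · refine hone.trans (le_add_of_le_right (le_add_of_le_right (le_add_of_le_left ?_)))
      rw [if_pos hw]
  refine (Finset.sum_le_sum fun σ _ => hle σ).trans ?_
  simp only [Finset.sum_add_distrib]
  refine add_le_add ?_ (add_le_add ?_ (add_le_add ?_ ?_))
  · rw [← Finset.sum_filter]
    refine (sum_iterate_branch_le hN hC m K φ).trans_eq ?_
    rw [simpleCount, Finset.card_filter]
    push_cast
    rfl
  · simp
  · rw [Finset.card_filter]; push_cast; exact le_rfl
  · rw [Finset.card_filter]; push_cast; exact le_rfl

lemma natCast_div_le_inv {a b q : ℕ} (hb : b ≠ 0) (h : a * q ≤ b) :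
    (a : ℝ≥0∞) / b ≤ (q : ℝ≥0∞)⁻¹ := by
  rw [ENNReal.div_le_iff (by simpa using hb) (by simp)]
  rw [← ENNReal.div_eq_inv_mul, ENNReal.le_div_iff_mul_le (Or.inr (by simpa using hb))
    (Or.inl (ENNReal.natCast_ne_top q))]
  exact_mod_cast h

/-- The probability that a uniformly random configuration is simple. -/
noncomputable def simpleProb (d : Fin n → ℕ) : ℝ≥0∞ :=
  (simpleCount d Set.univ : ℝ≥0∞) / Fintype.card (Configuration d)

/-- The core estimate: `D` and `N₀` depend only on `C` and `ε`, not on the rule or the event. -/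
lemma exists_bound (C : ℕ) {ε : ℝ≥0∞} (hε : ε ≠ 0) :
    ∃ D N₀ : ℕ, ∀ (n : ℕ) (d : Fin n → ℕ) (rule : Rule d), N₀ ≤ Fintype.card (HalfEdge d) →
      sqSum d ≤ C * Fintype.card (HalfEdge d) → Even (Fintype.card (HalfEdge d)) →
      1 ≤ D * simpleProb d + ε ∧
      ∀ E, terminalMeasure rule E ≤ D * (simpleProb d * uniformLaw d E) + ε := by
  classical
  obtain ⟨q, hq⟩ := ENNReal.exists_inv_nat_lt (a := ε / 3) (by simp [hε])
  have hq0 : 0 < q := by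
    rcases Nat.eq_zero_or_pos q with rfl | h
    · simp at hq
    · exact h
  -- By Markov's inequality, these `m` and `K` leave probability at most 1/q each for a heavy start
  -- and for too many bad half-edges. With `j`, the choice r = N/j + 1 makes the failure probability
  -- of the K steps at most 1/q too.
  set m := (2 * (C ^ 2 + C) + 1) * q with hm
  set K := (2 * C + 8 * C ^ 2 + 1) * q with hK
  set j := 10 * (K * q) with hj
  have hj0 : 0 < j := by positivity
  -- The first term of the threshold gives `hr`, the second gives `hη`, and the 4 ensures N ≥ 4.
  refine ⟨densityBound C m K, j ^ 4 * C ^ 3 + 2 * (K * q * (K + 5)) + 4, ?_⟩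
  intro n d rule hN hC heven
  set N := Fintype.card (HalfEdge d) with hNdef
  have hN4 : 4 ≤ N := by omega
  have : Nonempty (Configuration d) := nonempty_of_even heven
  have hcard : Fintype.card (Configuration d) ≠ 0 := Fintype.card_ne_zero
  have hr : sqSum d ^ 3 ≤ (N / j + 1) ^ 4 := by
    have h1 : N ≤ j * (N / j + 1) := (Nat.lt_mul_div_succ N hj0).le
    have h2 : j ^ 4 * C ^ 3 ≤ N := by omega
    refine _root_.le_of_mul_le_mul_left (a := j ^ 4) ?_ (by positivity)
    calc j ^ 4 * sqSum d ^ 3 ≤ j ^ 4 * (C * N) ^ 3 :=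
          Nat.mul_le_mul_left _ (Nat.pow_le_pow_left hC 3)
      _ = (j ^ 4 * C ^ 3) * N ^ 3 := by ring
      _ ≤ N * N ^ 3 := Nat.mul_le_mul_right _ h2
      _ = N ^ 4 := by ring
      _ ≤ (j * (N / j + 1)) ^ 4 := Nat.pow_le_pow_left h1 4
      _ = _ := by ring
  have hη : (K : ℝ≥0∞) * (((K + 5 * (N / j + 1) : ℕ) : ℝ≥0∞) / ((N - 2 : ℕ) : ℝ≥0∞)) ≤
      (q : ℝ≥0∞)⁻¹ := by
    rw [← mul_div_assoc, ← Nat.cast_mul]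
    refine natCast_div_le_inv (by omega) ?_
    have h1 : j * (N / j) ≤ N := Nat.mul_div_le N j
    have h2 : 2 * (K * (K + 5 * (N / j + 1)) * q) ≤ 2 * (N - 2) := by
      have h3 : 2 * (K * (K + 5 * (N / j + 1)) * q) =
          2 * (K * q * (K + 5)) + j * (N / j) := by rw [hj]; ring
      rw [h3]
      have h4 : 2 * (K * q * (K + 5)) + 4 ≤ N := by omega
      omega
    omega
  have hA : ((Finset.univ.filter fun σ : Configuration d => ¬ σ.weight ≤ m * N).card : ℝ≥0∞) /
      Fintype.card (Configuration d) ≤ (q : ℝ≥0∞)⁻¹ := by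
    refine natCast_div_le_inv hcard ?_
    have h1 := card_weight_gt_le hN4 hC m
    refine _root_.le_of_mul_le_mul_left (a := 2 * (C ^ 2 + C) + 1) ?_ (by positivity)
    calc _ = (Finset.univ.filter fun σ : Configuration d => ¬ σ.weight ≤ m * N).card * m := by
          rw [hm]; ring
      _ ≤ _ := h1
      _ ≤ Fintype.card (Configuration d) * (2 * (C ^ 2 + C) + 1) :=
          Nat.mul_le_mul_left _ (Nat.le_succ _)
      _ = _ := mul_comm _ _
  have hB : ((Finset.univ.filter fun σ : Configuration d => ¬ σ.badCount ≤ K).card : ℝ≥0∞) /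
      Fintype.card (Configuration d) ≤ (q : ℝ≥0∞)⁻¹ := by
    refine natCast_div_le_inv hcard ?_
    have h1 := card_badCount_gt_le hN4 hC K
    refine _root_.le_of_mul_le_mul_left (a := 2 * C + 8 * C ^ 2 + 1) ?_ (by positivity)
    calc _ = (Finset.univ.filter fun σ : Configuration d => ¬ σ.badCount ≤ K).card * K := by
          rw [hK]; ring
      _ ≤ _ := h1
      _ ≤ Fintype.card (Configuration d) * (2 * C + 8 * C ^ 2 + 1) :=
          Nat.mul_le_mul_left _ (Nat.le_succ _)
      _ = _ := mul_comm _ _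
  have hε3 : (q : ℝ≥0∞)⁻¹ + ((q : ℝ≥0∞)⁻¹ + (q : ℝ≥0∞)⁻¹) ≤ ε := by
    refine (add_le_add hq.le (add_le_add hq.le hq.le)).trans_eq ?_
    rw [← add_assoc, ENNReal.add_thirds]
  have hmain : ∀ E, (∑ σ : Configuration d, expect (run rule σ K)
      (fun s => if s.current.IsSimple → s.current.toGraph ∈ E then 1 else 0)) /
      Fintype.card (Configuration d) ≤
      densityBound C m K * (simpleProb d * uniformLaw d E) + ε := by
    intro E
    refine (ENNReal.div_le_div_right (sum_expect_run_le rule hN4 hC hr m K E) _).trans ?_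
    rw [ENNReal.add_div, ENNReal.add_div, ENNReal.add_div]
    refine add_le_add (le_of_eq ?_) (le_trans (add_le_add ?_ (add_le_add hA hB)) hε3)
    · rw [simpleCount_eq_mul_uniformLaw, simpleProb]
      simp only [ENNReal.div_eq_inv_mul]
      ring
    · rw [ENNReal.mul_div_right_comm, ENNReal.div_self (by simp) (by simp), one_mul]
      exact hη
  constructor
  · have h1 := hmain Set.univ
    have h2 : simpleProb d * uniformLaw d Set.univ = simpleProb d := by
      rw [simpleProb, ENNReal.mul_div_right_comm.symm, ← simpleCount_eq_mul_uniformLaw]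
    rw [h2] at h1
    refine le_trans ?_ h1
    simp only [Set.mem_univ, implies_true, if_true, expect_const, Finset.sum_const,
      Finset.card_univ, nsmul_eq_mul, mul_one]
    rw [ENNReal.div_self (by simp) (by simp)]
  · intro E
    rw [terminalMeasure_apply]
    refine iSup_le fun k => (monotone_eventProb rule E (le_max_left k K)).trans ?_
    refine le_trans (ENNReal.div_le_div_right (Finset.sum_le_sum fun σ _ => ?_) _) (hmain E)
    exact expect_run_le_of_isSimple rule σ E (le_max_right k K)

lemma simpleProb_le_one : simpleProb d ≤ 1 := by
  refine ENNReal.div_le_of_le_mul ?_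
  rw [one_mul, Nat.cast_le, simpleCount]
  exact Finset.card_le_univ _

lemma simpleProb_mul_uniformLaw_le (rule : Rule d) (E : Set (SimpleGraph (Fin n))) :
    simpleProb d * uniformLaw d E ≤ terminalMeasure rule E := by
  rw [terminalMeasure_apply]
  refine le_trans (le_of_eq ?_) (le_iSup _ 0)
  rw [eventProb_zero, simpleProb, ENNReal.mul_div_right_comm.symm,
    ← simpleCount_eq_mul_uniformLaw]

lemma terminalMeasure_le_one (rule : Rule d) (E : Set (SimpleGraph (Fin n))) :
    terminalMeasure rule E ≤ 1 := by
  rw [terminalMeasure_apply]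
  exact iSup_le fun k => eventProb_le_one rule k E

lemma switchedLaw_apply (rule : Rule d) (E : Set (SimpleGraph (Fin n))) :
    switchedLaw rule E = (terminalMeasure rule Set.univ)⁻¹ * terminalMeasure rule E := rfl

/-- A uniform lower bound for the probability that a random configuration is simple. -/
lemma exists_simpleProb_bound (C : ℕ) :
    ∃ M N₀ : ℕ, ∀ (n : ℕ) (d : Fin n → ℕ), Rule d → N₀ ≤ Fintype.card (HalfEdge d) →
      sqSum d ≤ C * Fintype.card (HalfEdge d) → Even (Fintype.card (HalfEdge d)) →
      1 ≤ M * simpleProb d := by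
  -- The bound concerns configurations only but is proved by running the process; any rule will do,
  -- hence the argument of type `Rule d`.
  obtain ⟨D, N₀, h⟩ := exists_bound C (ε := 2⁻¹) (by simp)
  refine ⟨2 * D, N₀, fun n d rule hN hC heven => ?_⟩
  have h1 := (h n d rule hN hC heven).1
  have h2 : (2⁻¹ : ℝ≥0∞) ≤ D * simpleProb d := by
    rw [← ENNReal.one_sub_inv_two]
    exact tsub_le_iff_right.2 h1
  calc (1 : ℝ≥0∞) = 2 * 2⁻¹ := (ENNReal.mul_inv_cancel two_ne_zero ENNReal.ofNat_ne_top).symm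
    _ ≤ 2 * (D * simpleProb d) := mul_le_mul_right h2 _
    _ = _ := by push_cast; ring

section

variable {M : ℕ}

lemma simpleCount_ne_zero (h : 1 ≤ M * simpleProb d) : simpleCount d Set.univ ≠ 0 := by
  intro h0
  simp [simpleProb, h0] at h

lemma one_le_mul_terminalMeasure (rule : Rule d) (h : 1 ≤ M * simpleProb d) :
    1 ≤ M * terminalMeasure rule Set.univ := by
  have := isProbabilityMeasure_uniformLaw (simpleCount_ne_zero h)
  refine h.trans (mul_le_mul_right ?_ _)
  simpa using simpleProb_mul_uniformLaw_le rule Set.univ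

lemma isProbabilityMeasure_switchedLaw (rule : Rule d) (h : 1 ≤ M * simpleProb d) :
    IsProbabilityMeasure (switchedLaw rule) := by
  refine ⟨?_⟩
  rw [switchedLaw_apply, ENNReal.inv_mul_cancel]
  · intro h0
    have := one_le_mul_terminalMeasure rule h
    simp [h0] at this
  · exact ((terminalMeasure_le_one rule _).trans_lt ENNReal.one_lt_top).ne

lemma uniformLaw_le (rule : Rule d) (h : 1 ≤ M * simpleProb d)
    (E : Set (SimpleGraph (Fin n))) : uniformLaw d E ≤ M * switchedLaw rule E := by
  calc uniformLaw d E ≤ M * simpleProb d * uniformLaw d E := le_mul_of_one_le_left' h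
    _ = M * (simpleProb d * uniformLaw d E) := mul_assoc _ _ _
    _ ≤ M * terminalMeasure rule E :=
        mul_le_mul_right (simpleProb_mul_uniformLaw_le rule E) _
    _ ≤ M * switchedLaw rule E := by
        refine mul_le_mul_right ?_ _
        rw [switchedLaw_apply]
        exact le_mul_of_one_le_left' (ENNReal.one_le_inv.2 (terminalMeasure_le_one rule _))

/-- Conditioning on termination costs at most a factor `M`, since the process terminates with
probability at least 1/M. -/
lemma switchedLaw_le (rule : Rule d) (h : 1 ≤ M * simpleProb d)
    (E : Set (SimpleGraph (Fin n))) : switchedLaw rule E ≤ M * terminalMeasure rule E := by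
  rw [switchedLaw_apply]
  refine mul_le_mul_left ?_ _
  rw [ENNReal.inv_le_iff_le_mul]
  · rw [mul_comm]; exact one_le_mul_terminalMeasure rule h
  · intro _ h0
    have := one_le_mul_terminalMeasure rule h
    simp [h0] at this
  · intro h0
    exact absurd h0 ((terminalMeasure_le_one rule _).trans_lt ENNReal.one_lt_top).ne

end

/-! ### Passage to the limit. -/

lemma holdsWhp_iff_compl {S : ℕ → Type*} [∀ n, MeasurableSpace (S n)] {μ : ∀ n, Measure (S n)}
    (hμ : ∀ᶠ n in atTop, IsProbabilityMeasure (μ n)) {E : ∀ n, Set (S n)}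
    (hE : ∀ n, MeasurableSet (E n)) :
    HoldsWhp μ E ↔ Tendsto (fun n => μ n (E n)ᶜ) atTop (𝓝 0) := by
  have h1 : ∀ᶠ n in atTop, μ n (E n)ᶜ = 1 - μ n (E n) := by
    filter_upwards [hμ] with n hn using prob_compl_eq_one_sub (hE n)
  have h2 : ∀ᶠ n in atTop, μ n (E n) = 1 - μ n (E n)ᶜ := by
    filter_upwards [hμ] with n hn
    rw [← prob_compl_eq_one_sub (hE n).compl, compl_compl]
  constructor
  · intro h
    rw [tendsto_congr' h1]
    simpa using ENNReal.Tendsto.sub (tendsto_const_nhds (x := (1 : ℝ≥0∞))) h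
      (Or.inl ENNReal.one_ne_top)
  · intro h
    rw [HoldsWhp, tendsto_congr' h2]
    simpa using ENNReal.Tendsto.sub (tendsto_const_nhds (x := (1 : ℝ≥0∞))) h
      (Or.inl ENNReal.one_ne_top)

/-- The lower half of the Θ-bound replaces n by the number of half-edges, in which all estimates are
stated. -/
lemma exists_sqSum_le {d : ∀ n : ℕ, Fin n → ℕ}
    (h_sum : (fun n : ℕ => ∑ i, (d n i : ℝ)) =Θ[atTop] fun n : ℕ => (n : ℝ))
    (h_sq : (fun n : ℕ => ∑ i, (d n i : ℝ) ^ 2) =O[atTop] fun n : ℕ => (n : ℝ)) :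
    Tendsto (fun n => Fintype.card (HalfEdge (d n))) atTop atTop ∧
      ∃ C : ℕ, ∀ᶠ n in atTop, sqSum (d n) ≤ C * Fintype.card (HalfEdge (d n)) := by
  obtain ⟨c₁, hc₁, h₁⟩ := h_sum.2.exists_pos
  obtain ⟨c₂, hc₂, h₂⟩ := h_sq.exists_pos
  have hs : ∀ n, (∑ i, (d n i : ℝ)) = (Fintype.card (HalfEdge (d n)) : ℝ) := by
    intro n
    rw [card_halfEdge]
    push_cast
    rfl
  have h₁' : ∀ᶠ n : ℕ in atTop, (n : ℝ) ≤ c₁ * Fintype.card (HalfEdge (d n)) := by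
    filter_upwards [h₁.bound] with n hn
    rw [hs] at hn
    rwa [Real.norm_of_nonneg (by positivity), Real.norm_of_nonneg (by positivity)] at hn
  have h₂' : ∀ᶠ n : ℕ in atTop, (sqSum (d n) : ℝ) ≤ c₂ * n := by
    filter_upwards [h₂.bound] with n hn
    rw [Real.norm_of_nonneg (by positivity), Real.norm_of_nonneg (by positivity)] at hn
    simpa [sqSum] using hn
  constructor
  · rw [← tendsto_natCast_atTop_iff (R := ℝ)]
    refine tendsto_atTop_mono' _ ?_ (tendsto_natCast_atTop_atTop.atTop_div_const hc₁)
    filter_upwards [h₁'] with n hn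
    rwa [div_le_iff₀' hc₁]
  · refine ⟨⌈c₂ * c₁⌉₊, ?_⟩
    filter_upwards [h₁', h₂'] with n hn₁ hn₂
    have h : (sqSum (d n) : ℝ) ≤ (⌈c₂ * c₁⌉₊ : ℝ) * Fintype.card (HalfEdge (d n)) :=
      calc (sqSum (d n) : ℝ) ≤ c₂ * n := hn₂
        _ ≤ c₂ * (c₁ * Fintype.card (HalfEdge (d n))) := by gcongr
        _ = c₂ * c₁ * Fintype.card (HalfEdge (d n)) := by ring
        _ ≤ _ := by gcongr; exact Nat.le_ceil _
    exact_mod_cast h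

end SwitchedGraph

open SwitchedGraph in
theorem theorem2 (d : ∀ n : ℕ, Fin n → ℕ)
    (h_even : ∀ᶠ n in atTop, Even (∑ i, d n i))
    (h_sum : (fun n : ℕ => ∑ i, (d n i : ℝ)) =Θ[atTop] fun n : ℕ => (n : ℝ))
    (h_sq : (fun n : ℕ => ∑ i, (d n i : ℝ) ^ 2) =O[atTop] fun n : ℕ => (n : ℝ))
    (rule : ∀ n, Rule (d n)) :
    (∀ᶠ n in atTop, IsProbabilityMeasure (switchedLaw (rule n)) ∧
      IsProbabilityMeasure (uniformLaw (d n))) ∧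
    Contiguous (fun n => switchedLaw (rule n)) (fun n => uniformLaw (d n)) ∧
    ∀ E : ∀ n, Set (SimpleGraph (Fin n)),
      HoldsWhp (fun n => switchedLaw (rule n)) E ↔ HoldsWhp (fun n => uniformLaw (d n)) E := by
  obtain ⟨hN, C, hC⟩ := exists_sqSum_le h_sum h_sq
  obtain ⟨M, N₀, hM⟩ := exists_simpleProb_bound C
  have hsimple : ∀ᶠ n in atTop, 1 ≤ M * simpleProb (d n) := by
    filter_upwards [h_even, hC, hN.eventually_ge_atTop N₀] with n h1 h2 h3
    exact hM n (d n) (rule n) h3 h2 (by rwa [card_halfEdge])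
  have hprob : ∀ᶠ n in atTop, IsProbabilityMeasure (switchedLaw (rule n)) ∧
      IsProbabilityMeasure (uniformLaw (d n)) := by
    filter_upwards [hsimple] with n hn
    exact ⟨isProbabilityMeasure_switchedLaw (rule n) hn,
      isProbabilityMeasure_uniformLaw (simpleCount_ne_zero hn)⟩
  have hcont : Contiguous (fun n => switchedLaw (rule n)) (fun n => uniformLaw (d n)) := by
    intro E _
    constructor
    · intro h
      have h1 : Tendsto (fun n => (M : ℝ≥0∞) * switchedLaw (rule n) (E n)) atTop (𝓝 0) := by
        simpa using ENNReal.Tendsto.const_mul h (Or.inr (ENNReal.natCast_ne_top M))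
      refine tendsto_of_tendsto_of_tendsto_of_le_of_le' tendsto_const_nhds h1
        (Eventually.of_forall fun _ => zero_le) ?_
      filter_upwards [hsimple] with n hn using uniformLaw_le (rule n) hn (E n)
    · intro h
      rw [ENNReal.tendsto_nhds_zero] at h ⊢
      intro ε hε
      -- `M` is fixed first; then the error term is made small compared with 1/M; only then is `D`
      -- known, and the uniform probability must be small compared with 1/(MD).
      have hδ : ε / 2 / (M + 1 : ℕ) ≠ 0 := by
        simp [hε.ne', ENNReal.div_eq_zero_iff]
      obtain ⟨D, N₁, hD⟩ := exists_bound C hδ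
      have hδ' : ε / 2 / (M + 1 : ℕ) / (D + 1 : ℕ) ≠ 0 := by
        rw [ne_eq, ENNReal.div_eq_zero_iff]
        simp only [hδ, false_or]
        exact ENNReal.natCast_ne_top _
      filter_upwards [hsimple, h_even, hC, hN.eventually_ge_atTop N₁,
        h _ (pos_iff_ne_zero.2 hδ')] with n h0 h1 h2 h3 h4
      have h5 := (hD n (d n) (rule n) h3 h2 (by rwa [card_halfEdge])).2 (E n)
      have hMle : (M : ℝ≥0∞) ≤ (M + 1 : ℕ) := Nat.cast_le.2 (Nat.le_succ M)
      have hDle : (D : ℝ≥0∞) ≤ (D + 1 : ℕ) := Nat.cast_le.2 (Nat.le_succ D)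
      have h6 : (D : ℝ≥0∞) * (simpleProb (d n) * uniformLaw (d n) (E n)) ≤
          ε / 2 / (M + 1 : ℕ) := by
        calc _ ≤ ((D + 1 : ℕ) : ℝ≥0∞) * (ε / 2 / (M + 1 : ℕ) / (D + 1 : ℕ)) :=
              mul_le_mul' hDle ((mul_le_of_le_one_left' simpleProb_le_one).trans h4)
          _ ≤ _ := ENNReal.mul_div_le
      calc switchedLaw (rule n) (E n) ≤ M * terminalMeasure (rule n) (E n) :=
            switchedLaw_le (rule n) h0 (E n)
        _ ≤ ((M + 1 : ℕ) : ℝ≥0∞) * (ε / 2 / (M + 1 : ℕ) + ε / 2 / (M + 1 : ℕ)) :=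
            mul_le_mul' hMle (h5.trans (add_le_add_left h6 _))
        _ = ((M + 1 : ℕ) : ℝ≥0∞) * (ε / 2 / (M + 1 : ℕ)) +
              ((M + 1 : ℕ) : ℝ≥0∞) * (ε / 2 / (M + 1 : ℕ)) := mul_add _ _ _
        _ ≤ ε / 2 + ε / 2 := add_le_add ENNReal.mul_div_le ENNReal.mul_div_le
        _ = ε := ENNReal.add_halves ε
  refine ⟨hprob, hcont, fun E => ?_⟩
  have hE : ∀ n, MeasurableSet (E n) := fun n => (Set.toFinite (E n)).measurableSet
  rw [holdsWhp_iff_compl (hprob.mono fun n h => h.1) hE,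
    holdsWhp_iff_compl (hprob.mono fun n h => h.2) hE]
  exact hcont (fun n => (E n)ᶜ) fun n => (hE n).compl
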